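/- **Setting.** For $n=(n_1,n_2,n_3,n_4)$ with all $n_i\ge 1$, the 4-cycle algebra with block sizes $n$ is the algebra $A\subseteq M_{n_1+n_2+n_3+n_4}(\mathbb C)$ of partitioned matrices $(a_{ij})$ with $a_{ij}\in M_{n_i,n_j}(\mathbb C)$ and $a_{ij}=0$ unless $(i,j)$ is an edge of the digraph $D_4$, whose edges are $(1,3),(1,4),(2,3),(2,4)$ and the loops $(i,i)$. For $n=(1,1,1,1)$ it is denoted $A(D_4)$, with matrix units $e_{ij}$. A homomorphism between 4-cycle algebras is star extendible if it extends to a (not necessarily unital) star homomorphism of the generated full matrix algebras. It is a *rigid* multiplicity one embedding, of type $\sigma$, if the extension maps rank one projections to rank one projections and the map carries the $(i,j)$ block into the $(\sigma(i),\sigma(j))$ block for each edge $i\neq j$, where $\sigma$ is one of the four symmetries of $D_4$. An embedding is *rigid* if it is conjugate, by a unitary of the range algebra, to a nonempty direct sum of rigid multiplicity one embeddings, and *generic* if moreover each of the four types occurs among the summands. $K_0(A)$ denotes $K_0(A\cap A^*)$. $H_1(A)$ denotes the first partial isometry homology group: 1-chains are generated by the classes $[v]$ of regular partial isometries $v\in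 A$ (orthogonal sums of rank one partial isometries of $A$ with initial and final projections in $A$), with $[uvw]=[v]$ for unitaries $u,w\in A\cap A^*$ and $[v_1+v_2]=[v_1]+[v_2]$ for orthogonal sums; 0-chains are defined in the same way by projections of $A$ up to unitary equivalence; $\partial[v]=[vv^*]-[v^*v]$; and the boundaries are generated by $[v_1]+[v_2]-[v_1v_2]$ with $v_1^*v_1=v_2v_2^*$. For a 4-cycle algebra, $H_1(A)\cong\mathbb Z$ is generated by the class $g_A$ of $[e_{13}]-[e_{23}]+[e_{24}]-[e_{14}]$, where $e_{ij}$ is a matrix unit of the $(i,j)$ block and the four matrix units involve one index from each block. A rigid embedding $\phi$ induces $K_0(\phi)$ and $H_1(\phi):[v]\mapsto[\phi(v)]$. The *homology range* of a rigid embedding $\alpha:A\to A'$ is the set of all $H_1(\beta)$ with $\beta:A\to A'$ rigid and $K_0(\beta)=K_0(\alpha)$; each $H_1(\beta)$ is identified with the integer $d$ for which $H_1(\beta)g_A=d\,g_{A'}$. Let $\mathcal A=(A_k,\alpha_k)$ be a direct system of 4-cycle algebras and rigid embeddings $\alpha_k:A_k\to A_{k+1}$, infinitely many of which are generic (a generic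 system), with limit algebra $A$, and put $K_0A=\varinjlim K_0(A_k)$ and $H_1A=\varinjlim H_1(A_k)$. The system is *hr-asymmetric* if for every $i\le j$ the homology range of $\alpha_j\circ\cdots\circ\alpha_i$ consists of positive integers only or of negative integers only. The *joint scale* $\Sigma A\subseteq K_0A\oplus H_1A$ is the set of all elements $\bigl(K_0\phi([e_{11}\oplus e_{33}]),\,(H_1\phi)(g)\bigr)$ given by rigid embeddings $\phi:A(D_4)\to A_k$, $k$ arbitrary, where $g=g_{A(D_4)}$. **Proposition 5.8.** Let $A$ be the limit algebra of a generic hr-asymmetric system of 4-cycle algebras. Then the joint scale $\Sigma A$ is not invariant under the homology inversion $\mathrm{id}\oplus -1$ of $K_0A\oplus H_1A$, that is, $(\mathrm{id}\oplus -1)(\Sigma A)\neq\Sigma A$. -/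

import Mathlib

open scoped Matrix

noncomputable section

namespace CycleAlg

/-! ### `K₀` of a star ring -/

/-- Projections in the matrix rings `M_n(R)`, for all `n`. -/
abbrev MatProj (R : Type) [NonUnitalRing R] [StarRing R] : Type :=
  Σ n : ℕ, {p : Matrix (Fin n) (Fin n) R // IsStarProjection p}

/-- The defining relations of `K₀`: `[p] = [q]` if `p = v*v`, `q = vv*` for a rectangular matrix `v`
over `R` (Murray-von Neumann equivalence), and `[p ⊕ q] = [p] + [q]`. -/
inductive K0Rel (R : Type) [NonUnitalRing R] [StarRing R] : FreeAbelianGroup (MatProj R) → Prop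
  | equiv (n m : ℕ) (p : {p : Matrix (Fin n) (Fin n) R // IsStarProjection p})
      (q : {q : Matrix (Fin m) (Fin m) R // IsStarProjection q})
      (v : Matrix (Fin m) (Fin n) R) (hp : vᴴ * v = p.1) (hq : v * vᴴ = q.1) :
      K0Rel R (FreeAbelianGroup.of ⟨n, p⟩ - FreeAbelianGroup.of ⟨m, q⟩)
  | sum (n m : ℕ) (p : {p : Matrix (Fin n) (Fin n) R // IsStarProjection p})
      (q : {q : Matrix (Fin m) (Fin m) R // IsStarProjection q})
      (r : {r : Matrix (Fin (n + m)) (Fin (n + m)) R // IsStarProjection r})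
      (h : r.1 = Matrix.reindex finSumFinEquiv finSumFinEquiv (Matrix.fromBlocks p.1 0 0 q.1)) :
      K0Rel R (FreeAbelianGroup.of ⟨n + m, r⟩ - FreeAbelianGroup.of ⟨n, p⟩
        - FreeAbelianGroup.of ⟨m, q⟩)

/-- `K₀(R)`: the Grothendieck group of the semigroup of Murray-von Neumann classes of projections
in matrices over `R`, presented by generators and relations. -/
abbrev K0 (R : Type) [NonUnitalRing R] [StarRing R] : Type :=
  FreeAbelianGroup (MatProj R) ⧸ AddSubgroup.closure {x | K0Rel R x}

namespace K0

variable {R S : Type} [NonUnitalRing R] [StarRing R] [NonUnitalRing S] [StarRing S]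

/-- The class in `K₀(R)` of a projection of `R`, seen as a `1 × 1` matrix. -/
def ofProj (p : R) (hp : IsStarProjection p) : K0 R :=
  QuotientAddGroup.mk (FreeAbelianGroup.of
    ⟨1, Matrix.of fun _ _ => p, by
      constructor
      · ext i j
        simpa [Matrix.mul_apply] using hp.isIdempotentElem.eq
      · ext i j
        simpa [Matrix.star_apply] using hp.isSelfAdjoint.star_eq⟩)

/-- A star homomorphism applied entrywise to a projection. -/
def mapProj (f : R →⋆ₙ+* S) (p : MatProj R) : MatProj S :=
  ⟨p.1, p.2.1.map f, by
    obtain ⟨n, p, hp⟩ := p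
    constructor
    · change p.map f * p.map f = p.map f
      rw [← Matrix.map_mul, hp.isIdempotentElem]
    · change (p.map f)ᴴ = p.map f
      rw [← Matrix.conjTranspose_map f (fun x => map_star f x)]
      exact congrArg (fun q => Matrix.map q f) hp.isSelfAdjoint⟩

/-- The homomorphism `K₀(f)` induced by a (not necessarily unital) star homomorphism. -/
def map (f : R →⋆ₙ+* S) : K0 R →+ K0 S :=
  QuotientAddGroup.map _ _ (FreeAbelianGroup.map (mapProj f)) (by
    rw [AddSubgroup.closure_le]
    rintro _ (⟨n, m, p, q, v, hp, hq⟩ | ⟨n, m, p, q, r, h⟩)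
    · apply AddSubgroup.subset_closure
      simp only [map_sub, FreeAbelianGroup.map_of_apply]
      refine K0Rel.equiv n m (mapProj f ⟨n, p⟩).2 (mapProj f ⟨m, q⟩).2 (v.map f) ?_ ?_
      · rw [← Matrix.conjTranspose_map f (fun x => map_star f x), ← Matrix.map_mul, hp]; rfl
      · rw [← Matrix.conjTranspose_map f (fun x => map_star f x), ← Matrix.map_mul, hq]; rfl
    · apply AddSubgroup.subset_closure
      simp only [map_sub, FreeAbelianGroup.map_of_apply]
      refine K0Rel.sum n m (mapProj f ⟨n, p⟩).2 (mapProj f ⟨m, q⟩).2 (mapProj f ⟨n + m, r⟩).2 ?_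
      simp only [mapProj, h]
      ext i j
      refine Fin.addCases (fun i => ?_) (fun i => ?_) i <;>
        refine Fin.addCases (fun j => ?_) (fun j => ?_) j <;> simp)

end K0

/-! ### Subalgebras of matrix algebras, star extendible maps, partial isometry homology -/

section General

variable {I J K : Type} [Fintype I] [DecidableEq I] [Fintype J] [DecidableEq J]
  [Fintype K] [DecidableEq K]

/-- The self-adjoint part `A ∩ A*`. -/
def selfAdj (A : Subalgebra ℂ (Matrix I I ℂ)) : StarSubalgebra ℂ (Matrix I I ℂ) where
  carrier := {x | x ∈ A ∧ star x ∈ A}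
  mul_mem' := fun ha hb => ⟨A.mul_mem ha.1 hb.1, by rw [star_mul]; exact A.mul_mem hb.2 ha.2⟩
  add_mem' := fun ha hb => ⟨A.add_mem ha.1 hb.1, by rw [star_add]; exact A.add_mem ha.2 hb.2⟩
  algebraMap_mem' := fun r => ⟨A.algebraMap_mem r, by
    rw [← algebraMap_star_comm]; exact A.algebraMap_mem _⟩
  star_mem' := fun ha => ⟨ha.2, by rw [star_star]; exact ha.1⟩

/-- A star extendible homomorphism `A → B` between algebras generating `M_I` and `M_J` as
C*-algebras, given by its (unique) extension to a star homomorphism `M_I → M_J`, which is not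
required to be unital. -/
structure StarExtHom (A : Subalgebra ℂ (Matrix I I ℂ)) (B : Subalgebra ℂ (Matrix J J ℂ)) where
  ext : Matrix I I ℂ →⋆ₙₐ[ℂ] Matrix J J ℂ
  map_mem : ∀ x ∈ A, ext x ∈ B

/-- The restriction `A ∩ A* → B ∩ B*` of a star extendible homomorphism. -/
def StarExtHom.restrict {A : Subalgebra ℂ (Matrix I I ℂ)} {B : Subalgebra ℂ (Matrix J J ℂ)}
    (f : StarExtHom A B) : selfAdj A →⋆ₙ+* selfAdj B where
  toFun x := ⟨f.ext x.1, f.map_mem _ x.2.1, by rw [← map_star]; exact f.map_mem _ x.2.2⟩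
  map_mul' x y := Subtype.ext (map_mul f.ext x.1 y.1)
  map_zero' := Subtype.ext (map_zero f.ext)
  map_add' x y := Subtype.ext (map_add f.ext x.1 y.1)
  map_star' x := Subtype.ext (map_star f.ext x.1)

/-- `K₀` of a subalgebra `A` of a full matrix algebra: its projections lie in `A ∩ A*`. -/
abbrev K0Alg (A : Subalgebra ℂ (Matrix I I ℂ)) : Type := K0 (selfAdj A)

/-- `K₀(f) : K₀(A) → K₀(B)`. -/
def StarExtHom.mapK0 {A : Subalgebra ℂ (Matrix I I ℂ)} {B : Subalgebra ℂ (Matrix J J ℂ)}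
    (f : StarExtHom A B) : K0Alg A →+ K0Alg B :=
  K0.map f.restrict

/-- A rank one partial isometry `w ∈ A` whose initial and final projections lie in `A`. -/
structure IsRankOnePI (A : Subalgebra ℂ (Matrix I I ℂ)) (w : Matrix I I ℂ) : Prop where
  mem : w ∈ A
  pisom : w * star w * w = w
  rank : w.rank = 1
  initial_mem : star w * w ∈ A
  final_mem : w * star w ∈ A

/-- A regular partial isometry of `A`: an orthogonal sum of rank one partial isometries of `A`
with initial and final projections in `A`. -/
def IsRegularPI (A : Subalgebra ℂ (Matrix I I ℂ)) (v : Matrix I I ℂ) : Prop :=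
  ∃ (ι : Type) (_ : Fintype ι) (w : ι → Matrix I I ℂ),
    (∀ s, IsRankOnePI A (w s)) ∧
    (∀ s t, s ≠ t → star (w s) * w t = 0 ∧ w s * star (w t) = 0) ∧
    v = ∑ s, w s

abbrev RegPI (A : Subalgebra ℂ (Matrix I I ℂ)) : Type := {v : Matrix I I ℂ // IsRegularPI A v}

abbrev Proj (A : Subalgebra ℂ (Matrix I I ℂ)) : Type :=
  {p : Matrix I I ℂ // p ∈ A ∧ IsStarProjection p}

/-- Unitaries of `A ∩ A*`. -/
def IsUnitaryIn (A : Subalgebra ℂ (Matrix I I ℂ)) (u : Matrix I I ℂ) : Prop :=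
  u ∈ selfAdj A ∧ star u * u = 1 ∧ u * star u = 1

/-- Relations between projection classes: unitary equivalence and orthogonal sums. -/
inductive ZeroChainRel (A : Subalgebra ℂ (Matrix I I ℂ)) : FreeAbelianGroup (Proj A) → Prop
  | equiv (p q : Proj A) (u : Matrix I I ℂ) (hu : IsUnitaryIn A u)
      (h : q.1 = u * p.1 * star u) :
      ZeroChainRel A (FreeAbelianGroup.of q - FreeAbelianGroup.of p)
  | sum (p p₁ p₂ : Proj A) (ho : p₁.1 * p₂.1 = 0) (h : p.1 = p₁.1 + p₂.1) :
      ZeroChainRel A (FreeAbelianGroup.of p - FreeAbelianGroup.of p₁ - FreeAbelianGroup.of p₂)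

/-- Relations between classes of regular partial isometries: `[uvw] = [v]` for unitaries `u, w` of
`A ∩ A*`, and `[v₁ + v₂] = [v₁] + [v₂]` for orthogonal sums. -/
inductive OneChainRel (A : Subalgebra ℂ (Matrix I I ℂ)) : FreeAbelianGroup (RegPI A) → Prop
  | equiv (v v' : RegPI A) (u w : Matrix I I ℂ) (hu : IsUnitaryIn A u) (hw : IsUnitaryIn A w)
      (h : v'.1 = u * v.1 * w) :
      OneChainRel A (FreeAbelianGroup.of v' - FreeAbelianGroup.of v)
  | sum (v v₁ v₂ : RegPI A) (hi : v₁.1 * star v₂.1 = 0) (hf : star v₁.1 * v₂.1 = 0)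
      (h : v.1 = v₁.1 + v₂.1) :
      OneChainRel A (FreeAbelianGroup.of v - FreeAbelianGroup.of v₁ - FreeAbelianGroup.of v₂)

/-- The 0-chain group. -/
abbrev C0 (A : Subalgebra ℂ (Matrix I I ℂ)) : Type :=
  FreeAbelianGroup (Proj A) ⧸ AddSubgroup.closure {x | ZeroChainRel A x}

/-- The 1-chain group. -/
abbrev C1 (A : Subalgebra ℂ (Matrix I I ℂ)) : Type :=
  FreeAbelianGroup (RegPI A) ⧸ AddSubgroup.closure {x | OneChainRel A x}

/-- The class `[p]` of a projection. -/
def C0.mk {A : Subalgebra ℂ (Matrix I I ℂ)} (p : Proj A) : C0 A :=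
  QuotientAddGroup.mk (FreeAbelianGroup.of p)

/-- The class `[v]` of a regular partial isometry. -/
def C1.mk {A : Subalgebra ℂ (Matrix I I ℂ)} (v : RegPI A) : C1 A :=
  QuotientAddGroup.mk (FreeAbelianGroup.of v)

theorem C0.mk_equiv {A : Subalgebra ℂ (Matrix I I ℂ)} (p q : Proj A) (u : Matrix I I ℂ)
    (hu : IsUnitaryIn A u) (h : q.1 = u * p.1 * star u) : C0.mk q = C0.mk p := by
  rw [← sub_eq_zero]
  exact (QuotientAddGroup.eq_zero_iff _).2
    (AddSubgroup.subset_closure (ZeroChainRel.equiv p q u hu h))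

theorem C0.mk_sum {A : Subalgebra ℂ (Matrix I I ℂ)} (p p₁ p₂ : Proj A) (ho : p₁.1 * p₂.1 = 0)
    (h : p.1 = p₁.1 + p₂.1) : C0.mk p = C0.mk p₁ + C0.mk p₂ := by
  rw [← sub_eq_zero, ← sub_sub]
  exact (QuotientAddGroup.eq_zero_iff _).2
    (AddSubgroup.subset_closure (ZeroChainRel.sum p p₁ p₂ ho h))

theorem IsRegularPI.initial {A : Subalgebra ℂ (Matrix I I ℂ)} {v : Matrix I I ℂ}
    (hv : IsRegularPI A v) : star v * v ∈ A ∧ IsStarProjection (star v * v) := by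
  obtain ⟨ι, _, w, hw, ho, rfl⟩ := hv
  classical
  have key : star (∑ s, w s) * ∑ s, w s = ∑ s, star (w s) * w s := by
    rw [star_sum, Finset.sum_mul]
    refine Finset.sum_congr rfl fun s _ => ?_
    rw [Finset.mul_sum, Finset.sum_eq_single s (fun t _ hts => (ho s t (Ne.symm hts)).1)
      (fun h => absurd (Finset.mem_univ s) h)]
  refine ⟨by rw [key]; exact A.sum_mem fun s _ => (hw s).initial_mem, ?_, ?_⟩
  · rw [key]
    change (∑ s, star (w s) * w s) * (∑ s, star (w s) * w s) = _
    rw [Finset.sum_mul]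
    refine Finset.sum_congr rfl fun s _ => ?_
    rw [Finset.mul_sum, Finset.sum_eq_single s]
    · rw [mul_assoc, ← mul_assoc (w s), (hw s).pisom]
    · intro t _ hts
      rw [mul_assoc, ← mul_assoc (w s), (ho s t (Ne.symm hts)).2, zero_mul, mul_zero]
    · exact fun h => absurd (Finset.mem_univ s) h
  · exact IsSelfAdjoint.star_mul_self _

theorem IsRegularPI.final {A : Subalgebra ℂ (Matrix I I ℂ)} {v : Matrix I I ℂ}
    (hv : IsRegularPI A v) : v * star v ∈ A ∧ IsStarProjection (v * star v) := by
  obtain ⟨ι, _, w, hw, ho, rfl⟩ := hv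
  classical
  have key : (∑ s, w s) * star (∑ s, w s) = ∑ s, w s * star (w s) := by
    rw [star_sum, Finset.sum_mul]
    refine Finset.sum_congr rfl fun s _ => ?_
    rw [Finset.mul_sum, Finset.sum_eq_single s (fun t _ hts => (ho s t (Ne.symm hts)).2)
      (fun h => absurd (Finset.mem_univ s) h)]
  refine ⟨by rw [key]; exact A.sum_mem fun s _ => (hw s).final_mem, ?_, ?_⟩
  · rw [key]
    change (∑ s, w s * star (w s)) * (∑ s, w s * star (w s)) = _
    rw [Finset.sum_mul]
    refine Finset.sum_congr rfl fun s _ => ?_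
    rw [Finset.mul_sum, Finset.sum_eq_single s]
    · rw [← mul_assoc, (hw s).pisom]
    · intro t _ hts
      rw [mul_assoc, ← mul_assoc (star (w s)), (ho s t (Ne.symm hts)).1, zero_mul, mul_zero]
    · exact fun h => absurd (Finset.mem_univ s) h
  · exact IsSelfAdjoint.mul_star_self _

/-- The initial projection `v*v`. -/
def RegPI.initial {A : Subalgebra ℂ (Matrix I I ℂ)} (v : RegPI A) : Proj A :=
  ⟨star v.1 * v.1, v.2.initial⟩

/-- The final projection `vv*`. -/
def RegPI.final {A : Subalgebra ℂ (Matrix I I ℂ)} (v : RegPI A) : Proj A :=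
  ⟨v.1 * star v.1, v.2.final⟩

theorem IsUnitaryIn.star {A : Subalgebra ℂ (Matrix I I ℂ)} {u : Matrix I I ℂ}
    (hu : IsUnitaryIn A u) : IsUnitaryIn A (star u) :=
  ⟨(selfAdj A).star_mem' hu.1, by rw [star_star]; exact hu.2.2, by rw [star_star]; exact hu.2.1⟩

/-- The boundary map `∂[v] = [vv*] - [v*v]`. -/
def boundary (A : Subalgebra ℂ (Matrix I I ℂ)) : C1 A →+ C0 A :=
  QuotientAddGroup.lift _
    (FreeAbelianGroup.lift fun v : RegPI A => C0.mk v.final - C0.mk v.initial) (by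
    rw [AddSubgroup.closure_le]
    rintro _ (⟨v, v', u, w, hu, hw, h⟩ | ⟨v, v₁, v₂, hi, hf, h⟩)
    · change FreeAbelianGroup.lift _ _ = 0
      rw [map_sub, FreeAbelianGroup.lift_apply_of, FreeAbelianGroup.lift_apply_of,
        C0.mk_equiv v.final v'.final u hu, C0.mk_equiv v.initial v'.initial _ hw.star, sub_self]
      · change Star.star v'.1 * v'.1 = Star.star w * (Star.star v.1 * v.1) * Star.star (Star.star w)
        rw [h, star_mul, star_mul, star_star]
        calc Star.star w * (Star.star v.1 * Star.star u) * (u * v.1 * w)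
            = Star.star w * Star.star v.1 * (Star.star u * u) * v.1 * w := by noncomm_ring
          _ = _ := by rw [hu.2.1]; noncomm_ring
      · change v'.1 * Star.star v'.1 = u * (v.1 * Star.star v.1) * Star.star u
        rw [h, star_mul, star_mul]
        calc u * v.1 * w * (Star.star w * (Star.star v.1 * Star.star u))
            = u * v.1 * (w * Star.star w) * Star.star v.1 * Star.star u := by noncomm_ring
          _ = _ := by rw [hw.2.2]; noncomm_ring
    · have hi' : v₂.1 * Star.star v₁.1 = 0 := by
        have := congrArg Star.star hi
        rwa [star_mul, star_star, star_zero] at this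
      have hf' : Star.star v₂.1 * v₁.1 = 0 := by
        have := congrArg Star.star hf
        rwa [star_mul, star_star, star_zero] at this
      change FreeAbelianGroup.lift _ _ = 0
      rw [map_sub, map_sub, FreeAbelianGroup.lift_apply_of, FreeAbelianGroup.lift_apply_of,
        FreeAbelianGroup.lift_apply_of, C0.mk_sum v.final v₁.final v₂.final,
        C0.mk_sum v.initial v₁.initial v₂.initial]
      · abel
      · change Star.star v₁.1 * v₁.1 * (Star.star v₂.1 * v₂.1) = 0
        rw [mul_assoc, ← mul_assoc v₁.1, hi, zero_mul, mul_zero]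
      · change Star.star v.1 * v.1 = Star.star v₁.1 * v₁.1 + Star.star v₂.1 * v₂.1
        rw [h, star_add, add_mul, mul_add, mul_add, hf, hf', add_zero, zero_add]
      · change v₁.1 * Star.star v₁.1 * (v₂.1 * Star.star v₂.1) = 0
        rw [mul_assoc, ← mul_assoc (Star.star v₁.1), hf, zero_mul, mul_zero]
      · change v.1 * Star.star v.1 = v₁.1 * Star.star v₁.1 + v₂.1 * Star.star v₂.1
        rw [h, star_add, add_mul, mul_add, mul_add, hi, hi', add_zero, zero_add])

/-- The boundaries of triangles of regular partial isometries: `v₃ = v₁v₂` with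
`v₁*v₁ = v₂v₂*` has boundary `[v₁] + [v₂] - [v₃]`. -/
def boundaries (A : Subalgebra ℂ (Matrix I I ℂ)) : AddSubgroup (C1 A) :=
  AddSubgroup.closure {x | ∃ v₁ v₂ v₃ : RegPI A, v₃.1 = v₁.1 * v₂.1 ∧
    star v₁.1 * v₁.1 = v₂.1 * star v₂.1 ∧ x = C1.mk v₁ + C1.mk v₂ - C1.mk v₃}

/-- The first partial isometry homology group: 1-cycles modulo boundaries of triangles. -/
abbrev H1 (A : Subalgebra ℂ (Matrix I I ℂ)) : Type :=
  (boundary A).ker ⧸ (boundaries A).addSubgroupOf (boundary A).ker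

/-- A star extendible homomorphism which maps regular partial isometries to regular partial
isometries. -/
structure RegHom (A : Subalgebra ℂ (Matrix I I ℂ)) (B : Subalgebra ℂ (Matrix J J ℂ))
    extends StarExtHom A B where
  map_regular : ∀ v, IsRegularPI A v → IsRegularPI B (ext v)

namespace RegHom

variable {A : Subalgebra ℂ (Matrix I I ℂ)} {B : Subalgebra ℂ (Matrix J J ℂ)}
  {C : Subalgebra ℂ (Matrix K K ℂ)}

/-- The identity map. -/
def id (A : Subalgebra ℂ (Matrix I I ℂ)) : RegHom A A where
  ext := NonUnitalStarAlgHom.id ℂ _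
  map_mem _ hx := hx
  map_regular _ hv := hv

/-- Composition `g ∘ f`. -/
def comp (g : RegHom B C) (f : RegHom A B) : RegHom A C where
  ext := g.ext.comp f.ext
  map_mem x hx := g.map_mem _ (f.map_mem x hx)
  map_regular v hv := g.map_regular _ (f.map_regular v hv)

/-- The image of a regular partial isometry. -/
def mapRegPI (f : RegHom A B) (v : RegPI A) : RegPI B := ⟨f.ext v.1, f.map_regular _ v.2⟩

/-- The image of a projection. -/
def mapProj (f : RegHom A B) (p : Proj A) : Proj B :=
  ⟨f.ext p.1, f.map_mem _ p.2.1, p.2.2.map f.ext⟩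

/-- A unitary `u` of `A ∩ A*` gives the unitary `f(u) + (1 - f(1))` of `B ∩ B*`. -/
theorem unitary_aux (f : RegHom A B) {u : Matrix I I ℂ} (hu : IsUnitaryIn A u) :
    ∃ U, IsUnitaryIn B U ∧ (∀ x, U * f.ext x = f.ext (u * x)) ∧
      (∀ x, f.ext x * U = f.ext (x * u)) := by
  have h1 : star (f.ext 1) = f.ext 1 := by rw [← map_star, star_one]
  have hmul (x y : Matrix I I ℂ) : f.ext x * f.ext y = f.ext (x * y) := (map_mul f.ext x y).symm
  have hst : star (f.ext u + (1 - f.ext 1)) = f.ext (star u) + (1 - f.ext 1) := by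
    rw [star_add, star_sub, star_one, h1, map_star]
  refine ⟨f.ext u + (1 - f.ext 1), ⟨⟨?_, ?_⟩, ?_, ?_⟩, fun x => ?_, fun x => ?_⟩
  · exact B.add_mem (f.map_mem _ hu.1.1) (B.sub_mem B.one_mem (f.map_mem _ A.one_mem))
  · rw [hst]
    exact B.add_mem (f.map_mem _ hu.1.2) (B.sub_mem B.one_mem (f.map_mem _ A.one_mem))
  · rw [hst]
    simp only [add_mul, mul_add, mul_sub, sub_mul, hmul, mul_one, one_mul, hu.2.1]
    abel
  · rw [hst]
    simp only [add_mul, mul_add, mul_sub, sub_mul, hmul, mul_one, one_mul, hu.2.2]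
    abel
  · simp only [add_mul, sub_mul, hmul, one_mul]
    abel
  · simp only [mul_add, mul_sub, hmul, mul_one]
    abel

/-- The induced map on 1-chains, `[v] ↦ [f(v)]`. -/
def mapC1 (f : RegHom A B) : C1 A →+ C1 B :=
  QuotientAddGroup.map _ _ (FreeAbelianGroup.map f.mapRegPI) (by
    rw [AddSubgroup.closure_le]
    rintro _ (⟨v, v', u, w, hu, hw, h⟩ | ⟨v, v₁, v₂, hi, hf, h⟩)
    · apply AddSubgroup.subset_closure
      simp only [map_sub, FreeAbelianGroup.map_of_apply]
      obtain ⟨U, hU, hU', -⟩ := f.unitary_aux hu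
      obtain ⟨W, hW, -, hW'⟩ := f.unitary_aux hw
      refine OneChainRel.equiv _ _ U W hU hW ?_
      change f.ext v'.1 = U * f.ext v.1 * W
      rw [hU', hW', h]
    · apply AddSubgroup.subset_closure
      simp only [map_sub, FreeAbelianGroup.map_of_apply]
      refine OneChainRel.sum _ _ _ ?_ ?_ ?_
      · change f.ext v₁.1 * star (f.ext v₂.1) = 0
        rw [← map_star, ← map_mul, hi, map_zero]
      · change star (f.ext v₁.1) * f.ext v₂.1 = 0
        rw [← map_star, ← map_mul, hf, map_zero]
      · change f.ext v.1 = f.ext v₁.1 + f.ext v₂.1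
        rw [h, map_add])

/-- The induced map on 0-chains, `[p] ↦ [f(p)]`. -/
def mapC0 (f : RegHom A B) : C0 A →+ C0 B :=
  QuotientAddGroup.map _ _ (FreeAbelianGroup.map f.mapProj) (by
    rw [AddSubgroup.closure_le]
    rintro _ (⟨p, q, u, hu, h⟩ | ⟨p, p₁, p₂, ho, h⟩)
    · apply AddSubgroup.subset_closure
      simp only [map_sub, FreeAbelianGroup.map_of_apply]
      obtain ⟨U, hU, hU', -⟩ := f.unitary_aux hu
      refine ZeroChainRel.equiv _ _ U hU ?_
      change f.ext q.1 = U * f.ext p.1 * star U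
      have hp : star (f.ext p.1) = f.ext p.1 := by rw [← map_star, p.2.2.isSelfAdjoint.star_eq]
      have hp' : f.ext p.1 = f.ext p.1 * star (f.ext p.1) := by
        rw [hp, ← map_mul, p.2.2.isIdempotentElem.eq]
      rw [hp', ← mul_assoc, hU', mul_assoc, ← star_mul, hU', h, ← map_star, ← map_mul, star_mul,
        p.2.2.isSelfAdjoint.star_eq]
      congr 1
      calc u * p.1 * star u = u * (p.1 * p.1) * star u := by rw [p.2.2.isIdempotentElem.eq]
        _ = _ := by noncomm_ring
    · apply AddSubgroup.subset_closure
      simp only [map_sub, FreeAbelianGroup.map_of_apply]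
      refine ZeroChainRel.sum _ _ _ ?_ ?_
      · change f.ext p₁.1 * f.ext p₂.1 = 0
        rw [← map_mul, ho, map_zero]
      · change f.ext p.1 = f.ext p₁.1 + f.ext p₂.1
        rw [h, map_add])

theorem boundary_mapC1 (f : RegHom A B) (x : C1 A) :
    boundary B (f.mapC1 x) = f.mapC0 (boundary A x) := by
  suffices h : (boundary B).comp f.mapC1 = f.mapC0.comp (boundary A) from DFunLike.congr_fun h x
  refine QuotientAddGroup.addMonoidHom_ext _ (FreeAbelianGroup.lift_ext _ _ fun v => ?_)
  have e1 : (f.mapRegPI v).final = f.mapProj v.final := Subtype.ext (by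
    change f.ext v.1 * star (f.ext v.1) = f.ext (v.1 * star v.1)
    rw [map_mul, map_star])
  have e2 : (f.mapRegPI v).initial = f.mapProj v.initial := Subtype.ext (by
    change star (f.ext v.1) * f.ext v.1 = f.ext (star v.1 * v.1)
    rw [map_mul, map_star])
  have hL : boundary B (f.mapC1 (C1.mk v))
      = C0.mk (f.mapRegPI v).final - C0.mk (f.mapRegPI v).initial := by
    simp [boundary, mapC1, C1.mk]
  have hR : f.mapC0 (boundary A (C1.mk v))
      = C0.mk (f.mapProj v.final) - C0.mk (f.mapProj v.initial) := by
    simp [boundary, mapC0, C1.mk, C0.mk]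
  exact hL.trans (Eq.trans (by rw [e1, e2]) hR.symm)

/-- The induced map on 1-cycles. -/
def mapZ1 (f : RegHom A B) : (boundary A).ker →+ (boundary B).ker :=
  (f.mapC1.comp (boundary A).ker.subtype).codRestrict (boundary B).ker (fun x => by
    rw [AddMonoidHom.mem_ker]
    change boundary B (f.mapC1 x.1) = 0
    rw [boundary_mapC1, AddMonoidHom.mem_ker.1 x.2, map_zero])

/-- The induced homomorphism `H₁(f)`. -/
def mapH1 (f : RegHom A B) : H1 A →+ H1 B :=
  QuotientAddGroup.map _ _ f.mapZ1 (by
    have key : boundaries A ≤ (boundaries B).comap f.mapC1 := by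
      refine (AddSubgroup.closure_le _).2 ?_
      rintro _ ⟨v₁, v₂, v₃, h, h', rfl⟩
      refine AddSubgroup.subset_closure
        ⟨f.mapRegPI v₁, f.mapRegPI v₂, f.mapRegPI v₃, ?_, ?_, ?_⟩
      · change f.ext v₃.1 = f.ext v₁.1 * f.ext v₂.1
        rw [h, map_mul]
      · change star (f.ext v₁.1) * f.ext v₁.1 = f.ext v₂.1 * star (f.ext v₂.1)
        rw [← map_star, ← map_star, ← map_mul, ← map_mul, h']
      · simp [mapC1, C1.mk]
    intro x hx
    exact key hx)

end RegHom

end General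

/-! ### 4-cycle algebras and rigid embeddings -/

/-- The edges of the 4-cycle digraph `D₄`; its vertices `1, 2, 3, 4` are here `0, 1, 2, 3`. -/
def D4 (i j : Fin 4) : Prop := i = j ∨ (i.val < 2 ∧ 2 ≤ j.val)

theorem D4.refl (i : Fin 4) : D4 i i := Or.inl rfl

theorem D4.of_lt {i j : Fin 4} (hi : i.val < 2) (hj : 2 ≤ j.val) : D4 i j := Or.inr ⟨hi, hj⟩

/-- Matrix indices for block sizes `n₁, n₂, n₃, n₄ ≥ 1`. -/
abbrev Idx (n : Fin 4 → ℕ+) : Type := Σ i : Fin 4, Fin (n i)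

/-- The 4-cycle algebra with block sizes `n`: the partitioned matrices supported in the blocks
`(i, j)` with `(i, j)` an edge of `D₄`. -/
def alg (n : Fin 4 → ℕ+) : Subalgebra ℂ (Matrix (Idx n) (Idx n) ℂ) where
  carrier := {x | ∀ a b, ¬ D4 a.1 b.1 → x a b = 0}
  mul_mem' := fun {x y} hx hy a b hab => by
    rw [Matrix.mul_apply]
    refine Finset.sum_eq_zero fun c _ => ?_
    by_cases h1 : D4 a.1 c.1
    · by_cases h2 : D4 c.1 b.1
      · exfalso
        apply hab
        unfold D4 at *
        rcases h1 with h1 | h1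
        · rw [h1]; exact h2
        · rcases h2 with h2 | h2
          · rw [← h2]; exact Or.inr h1
          · exact Or.inr ⟨h1.1, h2.2⟩
      · rw [hy c b h2, mul_zero]
    · rw [hx a c h1, zero_mul]
  add_mem' := fun {x y} hx hy a b hab => by
    rw [Matrix.add_apply, hx a b hab, hy a b hab, add_zero]
  algebraMap_mem' := fun r a b hab => by
    rw [Matrix.algebraMap_matrix_apply, if_neg]
    rintro rfl
    exact hab (Or.inl rfl)

/-- `A(D₄)`, the 4-cycle algebra in `M₄`. -/
abbrev algD4 : Subalgebra ℂ (Matrix (Idx fun _ => 1) (Idx fun _ => 1) ℂ) := alg fun _ => 1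

/-- The block subspace `(i, j)`. -/
def block (n : Fin 4 → ℕ+) (i j : Fin 4) : Set (Matrix (Idx n) (Idx n) ℂ) :=
  {x | ∀ a b, ¬ (a.1 = i ∧ b.1 = j) → x a b = 0}

/-- The (four) symmetries of the digraph `D₄`. -/
def IsSymmetry (σ : Equiv.Perm (Fin 4)) : Prop := ∀ i j, D4 (σ i) (σ j) ↔ D4 i j

/-- A star extendible embedding of multiplicity one (rank one projections go to rank one
projections) which is rigid: its images of the off-diagonal block subspaces lie in distinct
off-diagonal block subspaces, as given by the symmetry `σ` of `D₄`. -/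
structure IsRigidOne {n m : Fin 4 → ℕ+} (f : StarExtHom (alg n) (alg m))
    (σ : Equiv.Perm (Fin 4)) : Prop where
  symm : IsSymmetry σ
  multiplicity_one : ∀ p, IsStarProjection p → p.rank = 1 → (f.ext p).rank = 1
  map_block : ∀ i j, D4 i j → i ≠ j → ∀ x ∈ block n i j, f.ext x ∈ block m (σ i) (σ j)

/-- `f` is the orthogonal direct sum of multiplicity one rigid embeddings `φ s` of types `σ s`.
(A conjugate of such a sum by a unitary of the range algebra is again such a sum.) -/
structure IsRigidSum {n m : Fin 4 → ℕ+} (f : StarExtHom (alg n) (alg m)) {ι : Type} [Fintype ι]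
    (φ : ι → StarExtHom (alg n) (alg m)) (σ : ι → Equiv.Perm (Fin 4)) : Prop where
  rigid_one : ∀ s, IsRigidOne (φ s) (σ s)
  orthogonal : ∀ s t, s ≠ t → ∀ x y, (φ s).ext x * (φ t).ext y = 0
  sum_eq : ∀ x, f.ext x = ∑ s, (φ s).ext x

/-- Rigid embeddings: nonempty direct sums of multiplicity one rigid embeddings. -/
def IsRigid {n m : Fin 4 → ℕ+} (f : StarExtHom (alg n) (alg m)) : Prop :=
  ∃ (ι : Type) (_ : Fintype ι) (φ : ι → StarExtHom (alg n) (alg m))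
    (σ : ι → Equiv.Perm (Fin 4)), Nonempty ι ∧ IsRigidSum f φ σ

/-- Generic embeddings: direct sums of multiplicity one rigid embeddings with at least one
summand of each of the four types. -/
def IsGeneric {n m : Fin 4 → ℕ+} (f : StarExtHom (alg n) (alg m)) : Prop :=
  ∃ (ι : Type) (_ : Fintype ι) (φ : ι → StarExtHom (alg n) (alg m))
    (σ : ι → Equiv.Perm (Fin 4)), IsRigidSum f φ σ ∧ ∀ τ, IsSymmetry τ → ∃ s, σ s = τ

open scoped ComplexOrder in
/-- Rigid embeddings map regular partial isometries to regular partial isometries. -/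
theorem IsRigid.map_regular {n m : Fin 4 → ℕ+} {f : StarExtHom (alg n) (alg m)} (hf : IsRigid f)
    (v : Matrix (Idx n) (Idx n) ℂ) (hv : IsRegularPI (alg n) v) :
    IsRegularPI (alg m) (f.ext v) := by
  obtain ⟨κ, _, φ, σ, -, hφ⟩ := hf
  obtain ⟨ι, _, w, hw, ho, rfl⟩ := hv
  refine ⟨κ × ι, inferInstance, fun s => (φ s.1).ext (w s.2), fun s => ⟨?_, ?_, ?_, ?_, ?_⟩,
    ?_, ?_⟩
  · exact (φ s.1).map_mem _ (hw s.2).mem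
  · rw [← map_star, ← map_mul, ← map_mul, (hw s.2).pisom]
  · have hp : IsStarProjection (star (w s.2) * w s.2) := by
      refine ⟨?_, IsSelfAdjoint.star_mul_self _⟩
      change star (w s.2) * w s.2 * (star (w s.2) * w s.2) = _
      rw [mul_assoc, ← mul_assoc (w s.2), (hw s.2).pisom]
    have h := (hφ.rigid_one s.1).multiplicity_one _ hp
    rw [map_mul, map_star, Matrix.star_eq_conjTranspose, Matrix.star_eq_conjTranspose,
      Matrix.rank_conjTranspose_mul_self, Matrix.rank_conjTranspose_mul_self] at h
    exact h (hw s.2).rank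
  · rw [← map_star, ← map_mul]
    exact (φ s.1).map_mem _ (hw s.2).initial_mem
  · rw [← map_star, ← map_mul]
    exact (φ s.1).map_mem _ (hw s.2).final_mem
  · rintro ⟨s, a⟩ ⟨t, b⟩ hst
    simp only
    by_cases h : s = t
    · subst h
      have hab : a ≠ b := fun h => hst (by rw [h])
      rw [← map_star, ← map_mul, ← map_star, ← map_mul, (ho a b hab).1, (ho a b hab).2]
      exact ⟨map_zero _, map_zero _⟩
    · rw [← map_star, ← map_star]
      exact ⟨hφ.orthogonal s t h _ _, hφ.orthogonal s t h _ _⟩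
  · rw [hφ.sum_eq, Fintype.sum_prod_type]
    exact Finset.sum_congr rfl fun s _ => map_sum _ _ _

/-- A rigid embedding, as a map which preserves regular partial isometries. -/
def IsRigid.toRegHom {n m : Fin 4 → ℕ+} {f : StarExtHom (alg n) (alg m)} (hf : IsRigid f) :
    RegHom (alg n) (alg m) where
  toStarExtHom := f
  map_regular := hf.map_regular

/-! ### The standard generators -/

/-- The first index of block `i`. -/
def firstIdx (n : Fin 4 → ℕ+) (i : Fin 4) : Idx n := ⟨i, ⟨0, (n i).pos⟩⟩

/-- A matrix unit `e_{ij}` of the 4-cycle algebra with block sizes `n`. -/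
def unitMat (n : Fin 4 → ℕ+) (i j : Fin 4) : Matrix (Idx n) (Idx n) ℂ :=
  Matrix.single (firstIdx n i) (firstIdx n j) 1

theorem unitMat_mem (n : Fin 4 → ℕ+) {i j : Fin 4} (h : D4 i j) : unitMat n i j ∈ alg n := by
  intro a b hab
  refine Matrix.single_apply_of_ne _ _ _ _ _ ?_
  rintro ⟨rfl, rfl⟩
  exact hab h

theorem star_unitMat (n : Fin 4 → ℕ+) (i j : Fin 4) : star (unitMat n i j) = unitMat n j i := by
  simp [unitMat, Matrix.star_eq_conjTranspose, Matrix.conjTranspose_single]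

theorem unitMat_mul (n : Fin 4 → ℕ+) (i j k : Fin 4) :
    unitMat n i j * unitMat n j k = unitMat n i k := by
  simp [unitMat]

theorem unitMat_regular (n : Fin 4 → ℕ+) {i j : Fin 4} (h : D4 i j) :
    IsRegularPI (alg n) (unitMat n i j) := by
  refine ⟨Unit, inferInstance, fun _ => unitMat n i j, fun _ => ⟨unitMat_mem n h, ?_, ?_, ?_, ?_⟩,
    fun s t hst => absurd (Subsingleton.elim s t) hst, by simp⟩
  · rw [star_unitMat, unitMat_mul, unitMat_mul]
  · have : unitMat n i j
        = Matrix.vecMulVec (Pi.single (firstIdx n i) 1) (Pi.single (firstIdx n j) 1) := by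
      rw [unitMat, Matrix.single_eq_single_vecMulVec_single]
    rw [this]
    refine le_antisymm (Matrix.rank_vecMulVec_le _ _) ?_
    rw [← this, Nat.one_le_iff_ne_zero]
    intro h0
    have h1 : (unitMat n i j).mulVec (Pi.single (firstIdx n j) 1) = 0 := by
      have h2 : LinearMap.range (unitMat n i j).mulVecLin = ⊥ :=
        Submodule.finrank_eq_zero.1 h0
      have h3 := LinearMap.mem_range_self (unitMat n i j).mulVecLin (Pi.single (firstIdx n j) 1)
      rw [h2] at h3
      exact (Submodule.mem_bot ℂ).1 h3
    have := congrFun h1 (firstIdx n i)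
    simp [unitMat] at this
  · rw [star_unitMat, unitMat_mul]
    exact unitMat_mem n (Or.inl rfl)
  · rw [star_unitMat, unitMat_mul]
    exact unitMat_mem n (Or.inl rfl)

/-- The matrix unit `e_{ij}` of an edge of `D₄`, as a regular partial isometry. -/
def edge (n : Fin 4 → ℕ+) (i j : Fin 4) (h : D4 i j) : RegPI (alg n) :=
  ⟨unitMat n i j, unitMat_regular n h⟩

/-- The 1-chain `[e₁₃] - [e₂₃] + [e₂₄] - [e₁₄]` around the 4-cycle. -/
def cycleChain (n : Fin 4 → ℕ+) : C1 (alg n) :=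
  C1.mk (edge n 0 2 (D4.of_lt (by decide) (by decide))) - C1.mk (edge n 1 2 (D4.of_lt (by decide) (by decide)))
    + C1.mk (edge n 1 3 (D4.of_lt (by decide) (by decide))) - C1.mk (edge n 0 3 (D4.of_lt (by decide) (by decide)))

theorem boundary_edge (n : Fin 4 → ℕ+) (i j : Fin 4) (h : D4 i j) :
    boundary (alg n) (C1.mk (edge n i j h))
      = C0.mk (edge n i i (D4.refl i)).final - C0.mk (edge n j j (D4.refl j)).final := by
  have h1 : (edge n i j h).final = (edge n i i (D4.refl i)).final := Subtype.ext (by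
    change unitMat n i j * star (unitMat n i j) = unitMat n i i * star (unitMat n i i)
    rw [star_unitMat, star_unitMat, unitMat_mul, unitMat_mul])
  have h2 : (edge n i j h).initial = (edge n j j (D4.refl j)).final := Subtype.ext (by
    change star (unitMat n i j) * unitMat n i j = unitMat n j j * star (unitMat n j j)
    rw [star_unitMat, star_unitMat, unitMat_mul, unitMat_mul])
  have : boundary (alg n) (C1.mk (edge n i j h))
      = C0.mk (edge n i j h).final - C0.mk (edge n i j h).initial := by
    simp [boundary, C1.mk]
  rw [this, h1, h2]

theorem cycleChain_mem (n : Fin 4 → ℕ+) : cycleChain n ∈ (boundary (alg n)).ker := by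
  rw [AddMonoidHom.mem_ker, cycleChain, map_sub, map_add, map_sub]
  rw [boundary_edge, boundary_edge, boundary_edge, boundary_edge]
  abel

/-- The standard generator of `H₁ = ℤ` of the 4-cycle algebra with block sizes `n`. -/
def gen (n : Fin 4 → ℕ+) : H1 (alg n) := QuotientAddGroup.mk ⟨cycleChain n, cycleChain_mem n⟩

/-- The projection `e₁₁ ⊕ e₃₃` of `A(D₄)`. -/
def e11e33 : selfAdj algD4 :=
  ⟨unitMat _ 0 0 + unitMat _ 2 2,
    (alg _).add_mem (unitMat_mem _ (Or.inl rfl)) (unitMat_mem _ (Or.inl rfl)), by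
    rw [star_add, star_unitMat, star_unitMat]
    exact (alg _).add_mem (unitMat_mem _ (Or.inl rfl)) (unitMat_mem _ (Or.inl rfl))⟩

theorem isStarProjection_e11e33 : IsStarProjection e11e33 := by
  have h02 : unitMat (fun _ => 1) 0 0 * unitMat (fun _ => 1) 2 2 = 0 :=
    Matrix.single_mul_single_of_ne _ _ _ _ (fun h => absurd (congrArg Sigma.fst h) (by decide)) _
  have h20 : unitMat (fun _ => 1) 2 2 * unitMat (fun _ => 1) 0 0 = 0 :=
    Matrix.single_mul_single_of_ne _ _ _ _ (fun h => absurd (congrArg Sigma.fst h) (by decide)) _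
  constructor
  · refine Subtype.ext ?_
    change (unitMat _ 0 0 + unitMat _ 2 2) * (unitMat _ 0 0 + unitMat _ 2 2)
      = unitMat _ 0 0 + unitMat _ 2 2
    rw [add_mul, mul_add, mul_add, h02, h20, unitMat_mul, unitMat_mul, add_zero, zero_add]
  · refine Subtype.ext ?_
    change star (unitMat _ 0 0 + unitMat _ 2 2) = unitMat _ 0 0 + unitMat _ 2 2
    rw [star_add, star_unitMat, star_unitMat]

/-! ### Generic systems, homology range, joint scale -/

/-- A direct system `(A_k, α_k)` of 4-cycle algebras and rigid embeddings is generic if infinitely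
many of the embeddings are generic. -/
structure GenericSystem where
  n : ℕ → Fin 4 → ℕ+
  α : ∀ k, StarExtHom (alg (n k)) (alg (n (k + 1)))
  rigid : ∀ k, IsRigid (α k)
  generic : {k | IsGeneric (α k)}.Infinite

/-- The abstract homology range of `f`: all `H₁(β)` with `β` rigid and `K₀(β) = K₀(f)`. -/
def homologyRange {n m : Fin 4 → ℕ+} (f : StarExtHom (alg n) (alg m)) :
    Set (H1 (alg n) →+ H1 (alg m)) :=
  {h | ∃ (β : StarExtHom (alg n) (alg m)) (hβ : IsRigid β),
    β.mapK0 = f.mapK0 ∧ h = hβ.toRegHom.mapH1}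

namespace GenericSystem

variable (𝒜 : GenericSystem)

/-- The composition `α_{j-1} ∘ ⋯ ∘ α_i : A_i → A_j`. -/
def trans (i j : ℕ) (h : i ≤ j) : RegHom (alg (𝒜.n i)) (alg (𝒜.n j)) :=
  Nat.leRec (motive := fun j _ => RegHom (alg (𝒜.n i)) (alg (𝒜.n j)))
    (RegHom.id _) (fun k _ f => (𝒜.rigid k).toRegHom.comp f) h

/-- `K₀A = lim K₀(A_k)`. -/
abbrev K0Lim : Type :=
  AddCommGroup.DirectLimit (fun k => K0Alg (alg (𝒜.n k)))
    (fun i j h => (𝒜.trans i j h).toStarExtHom.mapK0)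

/-- `H₁A = lim H₁(A_k)`. -/
abbrev H1Lim : Type :=
  AddCommGroup.DirectLimit (fun k => H1 (alg (𝒜.n k))) (fun i j h => (𝒜.trans i j h).mapH1)

/-- The canonical map `K₀(A_k) → K₀A`. -/
def toK0Lim (k : ℕ) : K0Alg (alg (𝒜.n k)) →+ 𝒜.K0Lim :=
  AddCommGroup.DirectLimit.of (fun k => K0Alg (alg (𝒜.n k)))
    (fun i j h => (𝒜.trans i j h).toStarExtHom.mapK0) k

/-- The canonical map `H₁(A_k) → H₁A`. -/
def toH1Lim (k : ℕ) : H1 (alg (𝒜.n k)) →+ 𝒜.H1Lim :=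
  AddCommGroup.DirectLimit.of (fun k => H1 (alg (𝒜.n k)))
    (fun i j h => (𝒜.trans i j h).mapH1) k

/-- The joint scale `ΣA ⊆ K₀A ⊕ H₁A`: the elements `(K₀φ[e₁₁ ⊕ e₃₃], H₁φ(g))` for rigid
embeddings `φ : A(D₄) → A_k`, `k` arbitrary, `g` the standard generator of `H₁(A(D₄))`. -/
def jointScale : Set (𝒜.K0Lim × 𝒜.H1Lim) :=
  {x | ∃ (k : ℕ) (φ : StarExtHom algD4 (alg (𝒜.n k))) (hφ : IsRigid φ),
    x = (𝒜.toK0Lim k (φ.mapK0 (K0.ofProj e11e33 isStarProjection_e11e33)),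
      𝒜.toH1Lim k (hφ.toRegHom.mapH1 (gen _)))}

/-- The homology inversion `id ⊕ -1` of `K₀A ⊕ H₁A`. -/
def homologyInversion : 𝒜.K0Lim × 𝒜.H1Lim →+ 𝒜.K0Lim × 𝒜.H1Lim :=
  (AddMonoidHom.id 𝒜.K0Lim).prodMap (-AddMonoidHom.id 𝒜.H1Lim)

/-- The system is hr-asymmetric: for all `i < j` the homology range of the composition
`A_i → A_j` consists of positive integers only or of negative integers only, where `h` is
identified with the integer `d` such that `h(g_i) = d g_j` for the standard generators. -/
def IsHrAsymmetric : Prop :=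
  ∀ i j (hij : i < j),
    (∀ h ∈ homologyRange (𝒜.trans i j hij.le).toStarExtHom,
      ∃ d : ℤ, 0 < d ∧ h (gen (𝒜.n i)) = d • gen (𝒜.n j)) ∨
    (∀ h ∈ homologyRange (𝒜.trans i j hij.le).toStarExtHom,
      ∃ d : ℤ, d < 0 ∧ h (gen (𝒜.n i)) = d • gen (𝒜.n j))

end GenericSystem

end CycleAlg

end

noncomputable section

namespace CycleAlg

/-! ### Rank one matrices and multiplicity one homomorphisms -/

/-! The class of `e₁₁ ⊕ e₃₃` records the vertex multiplicities of a rigid map, but not how they pair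
up into types. That pairing is what homology sees, and it can be changed without changing `K₀`.

A rigid map has the form `x ↦ ∑ W_s x W_s*`, where the isometries `W_s` have orthogonal ranges and
`W_s` permutes the blocks by a symmetry `σ s` (`IsRigid.exists_isFramed`, with converse
`IsFramed.isRigid`). Two invariants are read from the types. Block traces on `K₀` give the number of
`s` with `σ s i = j` for `i = 0, 2` (`card_eq_of_mapK0_eq`). A homomorphism `weightH1` from `H₁` to
`ℂ`, with value 1 on the generator, gives the integer of `H₁` as the sum of the degrees `±1` of the
types (`IsFramed.weightH1_map_gen`).

Suppose the joint scale is invariant. The corner embedding `φ` of `A(D₄)` in the first algebra then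
has a partner `ψ` with equal `K₀` class and opposite homology in the limit, hence already at some
stage `k`. Let `α` be the connecting map from stage 0 to stage `k`. The types of `α` and those of
`ψ` pushed to stage `k` have equal vertex multiplicities. Recombining the isometries of `α` block by
block therefore gives a rigid `β` with the types of the latter and with `β = α` on `A ∩ A*`
(`exists_matching`, `IsFramed.exists_of_matching`). Thus `K₀(β) = K₀(α)` and `H₁(β) = -H₁(α)`: the
homology range of `α` contains both signs. -/

theorem exists_vecMulVec_of_rank_eq_one {I J : Type} [Fintype I] [Fintype J]
    {w : Matrix I J ℂ} (h : w.rank = 1) :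
    ∃ (x : I → ℂ) (y : J → ℂ), w = Matrix.vecMulVec x y := by
  classical
  -- The column space is a line, so each column is a multiple of one vector `x`; the multipliers
  -- form the row factor.
  obtain ⟨x, -, hx⟩ := finrank_eq_one_iff'.1 h
  have hc (j : J) : ∃ c : ℂ, c • (x : I → ℂ) = w.col j := by
    obtain ⟨c, hc⟩ := hx ⟨w.mulVecLin (Pi.single j 1), LinearMap.mem_range_self _ _⟩
    refine ⟨c, ?_⟩
    have := congrArg Subtype.val hc
    simpa using this
  choose y hy using hc
  refine ⟨x, y, ?_⟩
  ext i j
  have := congrFun (hy j) i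
  simp only [Pi.smul_apply, smul_eq_mul, Matrix.col_apply] at this
  rw [Matrix.vecMulVec_apply, ← this, mul_comm]

/-- Multiplication never raises the rank, and compressing by `Wᴴ` and `W` recovers `p`. -/
theorem rank_isometry_conj {I J : Type} [Fintype I] [DecidableEq I] [Fintype J] {W : Matrix J I ℂ}
    (hW : Wᴴ * W = 1) (p : Matrix I I ℂ) : (W * p * Wᴴ).rank = p.rank := by
  refine le_antisymm ((Matrix.rank_mul_le_left _ _).trans (Matrix.rank_mul_le_right _ _)) ?_
  have : p = Wᴴ * (W * p * Wᴴ) * W := by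
    calc p = (Wᴴ * W) * p * (Wᴴ * W) := by rw [hW, Matrix.one_mul, Matrix.mul_one]
      _ = _ := by simp only [Matrix.mul_assoc]
  conv_lhs => rw [this]
  exact (Matrix.rank_mul_le_left _ _).trans (Matrix.rank_mul_le_right _ _)

theorem rank_single_self {I : Type} [Fintype I] [DecidableEq I] (i : I) :
    (Matrix.single i i (1 : ℂ)).rank = 1 := by
  have hV : (Matrix.single i () (1 : ℂ))ᴴ * Matrix.single i () (1 : ℂ) = 1 := by
    ext
    simp [Matrix.conjTranspose_single]
  have h := rank_isometry_conj hV 1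
  rwa [Matrix.mul_one, Matrix.conjTranspose_single, star_one, Matrix.single_mul_single_same,
    mul_one, Matrix.rank_one, Fintype.card_unit] at h

open scoped ComplexOrder in
theorem exists_unit_of_isStarProjection_of_rank_eq_one {J : Type} [Fintype J]
    {q : Matrix J J ℂ} (hq : IsStarProjection q) (h : q.rank = 1) :
    ∃ y : J → ℂ, star y ⬝ᵥ y = 1 ∧ q = Matrix.vecMulVec y (star y) := by
  classical
  obtain ⟨x, z, hxz⟩ := exists_vecMulVec_of_rank_eq_one h
  -- The identity `q = q qᴴ` replaces the row factor by a multiple of `star x`; the square root of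
  -- the scalar is then absorbed into `x`, and idempotency forces norm one.
  have hqq : q = (z ⬝ᵥ star z) • Matrix.vecMulVec x (star x) := by
    have h1 : q * qᴴ = q := by
      rw [← Matrix.star_eq_conjTranspose, hq.isSelfAdjoint.star_eq, hq.isIdempotentElem.eq]
    rw [← h1, hxz, Matrix.conjTranspose_vecMulVec, Matrix.vecMulVec_mul_vecMulVec,
      Matrix.vecMulVec_smul]
  obtain ⟨c, hc0, hc⟩ : ∃ c : ℝ, 0 ≤ c ∧ z ⬝ᵥ star z = c := by
    have h1 := dotProduct_self_star_nonneg z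
    exact ⟨_, (Complex.le_def.1 h1).1, Complex.eq_re_of_ofReal_le (r := 0) (by simp)⟩
  have hy : q = Matrix.vecMulVec ((√c : ℂ) • x) (star ((√c : ℂ) • x)) := by
    rw [hqq, hc, star_smul, Matrix.vecMulVec_smul, Matrix.smul_vecMulVec, smul_smul]
    congr 1
    simp only [RCLike.star_def, Complex.conj_ofReal]
    rw [← Complex.ofReal_mul, Real.mul_self_sqrt hc0]
  refine ⟨_, ?_, hy⟩
  have h2 := hq.isIdempotentElem.eq
  rw [hy, Matrix.vecMulVec_mul_vecMulVec, Matrix.vecMulVec_smul, ← hy] at h2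
  have h3 : q ≠ 0 := by
    rintro rfl
    simp at h
  by_contra hne
  have h4 : (star ((√c : ℂ) • x) ⬝ᵥ ((√c : ℂ) • x) - 1) • q = 0 := by
    rw [sub_smul, h2, one_smul, sub_self]
  rcases smul_eq_zero.1 h4 with h5 | h5
  · exact hne (sub_eq_zero.1 h5)
  · exact h3 h5

/-- A star homomorphism of matrix algebras which maps a rank one diagonal matrix unit to a rank
one projection is implemented by an isometry. -/
theorem exists_isometry_of_rank_eq_one {I J : Type} [Fintype I] [DecidableEq I] [Fintype J]
    (f : Matrix I I ℂ →⋆ₙₐ[ℂ] Matrix J J ℂ) (i₀ : I)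
    (h : (f (Matrix.single i₀ i₀ 1)).rank = 1) :
    ∃ W : Matrix J I ℂ, Wᴴ * W = 1 ∧ ∀ x, f x = W * x * Wᴴ := by
  have hp : IsStarProjection (Matrix.single i₀ i₀ (1 : ℂ)) := by
    constructor
    · simp [IsIdempotentElem]
    · simp [IsSelfAdjoint, Matrix.star_eq_conjTranspose, Matrix.conjTranspose_single]
  obtain ⟨y, hy, hq⟩ := exists_unit_of_isStarProjection_of_rank_eq_one (hp.map f) h
  have hfy : f (Matrix.single i₀ i₀ 1) *ᵥ y = y := by
    rw [hq, Matrix.vecMulVec_mulVec, hy]; simp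
  -- The unit vector `y` spans the range of `f(e_{i₀i₀})`; its translates under the `f(e_{b i₀})`
  -- are orthonormal and serve as columns.
  let W : Matrix J I ℂ := Matrix.of fun a b => (f (Matrix.single b i₀ 1) *ᵥ y) a
  have hcol (b : I) : (fun a => W a b) = f (Matrix.single b i₀ 1) *ᵥ y := rfl
  have hst (a b : I) : (f (Matrix.single a b 1))ᴴ = f (Matrix.single b a 1) := by
    rw [← Matrix.star_eq_conjTranspose, ← map_star, Matrix.star_eq_conjTranspose,
      Matrix.conjTranspose_single, star_one]
  refine ⟨W, ?_, fun x => ?_⟩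
  · ext a b
    have : (Wᴴ * W) a b = star (f (Matrix.single a i₀ 1) *ᵥ y) ⬝ᵥ
        (f (Matrix.single b i₀ 1) *ᵥ y) := rfl
    rw [this, Matrix.star_mulVec, hst, ← Matrix.dotProduct_mulVec, Matrix.mulVec_mulVec, ← map_mul]
    by_cases hab : a = b
    · subst hab
      simp [hfy, hy]
    · rw [Matrix.single_mul_single_of_ne _ _ _ _ hab]
      simp [hab]
  · have hsingle (a b : I) : f (Matrix.single a b 1) = W * Matrix.single a b (1 : ℂ) * Wᴴ := by
      -- Factoring through `e_{i₀i₀}` brings in the projection `y y*`, so `f(e_{ab})` is column `a`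
      -- times the adjoint of column `b`.
      have h1 : Matrix.single a b (1 : ℂ) = Matrix.single a i₀ 1 * Matrix.single i₀ i₀ 1 *
          Matrix.single i₀ b 1 := by simp
      conv_lhs => rw [h1]
      rw [map_mul, map_mul, hq, Matrix.mul_vecMulVec, Matrix.vecMulVec_mul, ← hst b i₀,
        ← Matrix.star_mulVec]
      rw [Matrix.single_eq_single_vecMulVec_single (i := a) (j := b), Matrix.mul_vecMulVec,
        Matrix.vecMulVec_mul]
      congr 1
      · rw [← hcol]
        ext c
        simp
      · rw [← hcol]
        ext c
        simp
    rw [Matrix.matrix_eq_sum_single x]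
    simp only [map_sum, Matrix.mul_sum, Matrix.sum_mul]
    refine Finset.sum_congr rfl fun a _ => Finset.sum_congr rfl fun b _ => ?_
    have : Matrix.single a b (x a b) = x a b • Matrix.single a b 1 := by simp
    rw [this, map_smul, hsingle, Matrix.mul_smul, Matrix.smul_mul]

/-! ### Symmetries of `D₄` -/

theorem D4.iff {i j : Fin 4} : D4 i j ↔ i = j ∨ (i.val < 2 ∧ 2 ≤ j.val) := Iff.rfl

instance (i j : Fin 4) : Decidable (D4 i j) := decidable_of_iff _ D4.iff.symm

instance (σ : Equiv.Perm (Fin 4)) : Decidable (IsSymmetry σ) :=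
  inferInstanceAs (Decidable (∀ i j, D4 (σ i) (σ j) ↔ D4 i j))

theorem IsSymmetry.val_lt_two {σ : Equiv.Perm (Fin 4)} (hσ : IsSymmetry σ) (i : Fin 4) :
    (σ i).val < 2 ↔ i.val < 2 := by
  revert i σ; decide

/-- With `IsSymmetry.apply_three`, this makes a symmetry depend only on its values at `0` and `2`,
so multiplicities need to be compared only at these two vertices. -/
theorem IsSymmetry.apply_one {σ : Equiv.Perm (Fin 4)} (hσ : IsSymmetry σ) :
    σ 1 = Equiv.swap 0 1 (σ 0) := by
  revert σ; decide

theorem IsSymmetry.apply_three {σ : Equiv.Perm (Fin 4)} (hσ : IsSymmetry σ) :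
    σ 3 = Equiv.swap 2 3 (σ 2) := by
  revert σ; decide

/-! ### Frames -/

/-- A family of isometries with pairwise orthogonal ranges, the `s`-th of which maps the block `i`
into the block `σ s i`, for a symmetry `σ s` of `D₄`. -/
structure IsFrame {n m : Fin 4 → ℕ+} {ι : Type} (W : ι → Matrix (Idx m) (Idx n) ℂ)
    (σ : ι → Equiv.Perm (Fin 4)) : Prop where
  symm : ∀ s, IsSymmetry (σ s)
  isometry : ∀ s, (W s)ᴴ * W s = 1
  orthogonal : ∀ s t, s ≠ t → (W s)ᴴ * W t = 0
  block : ∀ s a b, W s a b ≠ 0 → a.1 = σ s b.1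

/-- `f x = ∑ W_s x W_s*` for a frame `W` of types `σ`. -/
structure IsFramed {n m : Fin 4 → ℕ+} {ι : Type} [Fintype ι] (f : StarExtHom (alg n) (alg m))
    (W : ι → Matrix (Idx m) (Idx n) ℂ) (σ : ι → Equiv.Perm (Fin 4)) : Prop extends
    IsFrame W σ where
  ext_eq : ∀ x, f.ext x = ∑ s, W s * x * (W s)ᴴ

/-! ### Rigid embeddings are the framed homomorphisms. -/

theorem IsRigidOne.exists_isometry {n m : Fin 4 → ℕ+} {f : StarExtHom (alg n) (alg m)}
    {σ : Equiv.Perm (Fin 4)} (hf : IsRigidOne f σ) :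
    ∃ W : Matrix (Idx m) (Idx n) ℂ, Wᴴ * W = 1 ∧ (∀ a b, W a b ≠ 0 → a.1 = σ b.1) ∧
      ∀ x, f.ext x = W * x * Wᴴ := by
  have hp : IsStarProjection (unitMat n 0 0) := by
    constructor
    · exact unitMat_mul n 0 0 0
    · exact star_unitMat n 0 0
  have hr : (unitMat n 0 0).rank = 1 := rank_single_self _
  obtain ⟨W, hW, hfW⟩ := exists_isometry_of_rank_eq_one f.ext (firstIdx n 0)
    (hf.multiplicity_one _ hp hr)
  refine ⟨W, hW, ?_, hfW⟩
  have hne (b : Idx n) : ∃ a, W a b ≠ 0 := by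
    by_contra! h
    have h1 := congrFun (congrFun hW b) b
    rw [Matrix.mul_apply] at h1
    simp [h] at h1
  -- The image of `e_{bd}` has `(a, c)` entry `W a b * star (W c d)`; where this is nonzero,
  -- rigidity places `(a, c)` in the prescribed block.
  have hent (a c : Idx m) (b d : Idx n) (h1 : b.1.val < 2) (h2 : 2 ≤ d.1.val)
      (ha : W a b ≠ 0) (hc : W c d ≠ 0) : a.1 = σ b.1 ∧ c.1 = σ d.1 := by
    by_contra h
    have hx : Matrix.single b d (1 : ℂ) ∈ CycleAlg.block n b.1 d.1 := by
      intro a' b' hab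
      refine Matrix.single_apply_of_ne _ _ _ _ _ ?_
      rintro ⟨rfl, rfl⟩
      exact hab ⟨rfl, rfl⟩
    have h0 := hf.map_block b.1 d.1 (D4.of_lt h1 h2) (fun h => by rw [h] at h1; omega) _ hx a c h
    rw [hfW, Matrix.single_eq_single_vecMulVec_single, Matrix.mul_vecMulVec,
      Matrix.vecMulVec_mul, Matrix.vecMulVec_apply] at h0
    simp [ha, hc] at h0
  intro a b hab
  by_cases hb : b.1.val < 2
  -- Columns of an isometry are nonzero, so any index on the other side of the digraph supplies the
  -- partner that `hent` needs.
  · obtain ⟨c, hc⟩ := hne (firstIdx n 2)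
    exact (hent a c b (firstIdx n 2) hb (by simp [firstIdx]) hab hc).1
  · obtain ⟨c, hc⟩ := hne (firstIdx n 0)
    exact (hent c a (firstIdx n 0) b (by simp [firstIdx]) (by omega) hc hab).2

theorem IsRigid.exists_isFramed {n m : Fin 4 → ℕ+} {f : StarExtHom (alg n) (alg m)}
    (hf : IsRigid f) :
    ∃ (ι : Type) (_ : Fintype ι) (W : ι → Matrix (Idx m) (Idx n) ℂ)
      (σ : ι → Equiv.Perm (Fin 4)), Nonempty ι ∧ IsFramed f W σ := by
  obtain ⟨ι, _, φ, σ, hne, h⟩ := hf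
  choose W hW hblock hφ using fun s => (h.rigid_one s).exists_isometry
  refine ⟨ι, inferInstance, W, σ, hne, ⟨fun s => (h.rigid_one s).symm, hW, ?_, hblock⟩, ?_⟩
  · intro s t hst
    -- At the identity, orthogonality concerns the range projections; cancelling the isometries
    -- leaves `(W s)ᴴ * W t = 0`.
    have h0 := h.orthogonal s t hst 1 1
    rw [hφ, hφ, Matrix.mul_one, Matrix.mul_one] at h0
    calc (W s)ᴴ * W t = ((W s)ᴴ * W s) * (W s)ᴴ * (W t * ((W t)ᴴ * W t)) := by
          rw [hW, hW, Matrix.one_mul, Matrix.mul_one]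
      _ = (W s)ᴴ * (W s * (W s)ᴴ * (W t * (W t)ᴴ)) * W t := by simp only [Matrix.mul_assoc]
      _ = 0 := by rw [h0]; simp
  · intro x
    rw [h.sum_eq]
    exact Finset.sum_congr rfl fun s _ => hφ s x

/-- The homomorphism `x ↦ ∑ W_s x W_s*` given by a frame. -/
def IsFrame.toHom {n m : Fin 4 → ℕ+} {ι : Type} [Fintype ι]
    {W : ι → Matrix (Idx m) (Idx n) ℂ} {σ : ι → Equiv.Perm (Fin 4)} (h : IsFrame W σ) :
    StarExtHom (alg n) (alg m) where
  ext :=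
    { toFun := fun x => ∑ s, W s * x * (W s)ᴴ
      map_smul' := fun c x => by simp [Finset.smul_sum]
      map_zero' := by simp
      map_add' := fun x y => by simp [Matrix.mul_add, Matrix.add_mul, Finset.sum_add_distrib]
      map_mul' := fun x y => by
        rw [Finset.sum_mul]
        refine Finset.sum_congr rfl fun s _ => ?_
        rw [Finset.mul_sum, Finset.sum_eq_single s]
        · calc W s * (x * y) * (W s)ᴴ = W s * x * (1 : Matrix (Idx n) (Idx n) ℂ) * y * (W s)ᴴ := by
                simp only [Matrix.mul_assoc, Matrix.one_mul]
            _ = _ := by rw [← h.isometry s]; simp only [Matrix.mul_assoc]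
        · intro t _ hts
          calc W s * x * (W s)ᴴ * (W t * y * (W t)ᴴ)
              = W s * x * ((W s)ᴴ * W t) * y * (W t)ᴴ := by simp only [Matrix.mul_assoc]
            _ = 0 := by rw [h.orthogonal s t hts.symm]; simp
        · exact fun hs => absurd (Finset.mem_univ s) hs
      map_star' := fun x => by
        simp [Matrix.star_eq_conjTranspose, Matrix.mul_assoc] }
  map_mem := fun x hx a b hab => by
    change (∑ s, W s * x * (W s)ᴴ) a b = 0
    rw [Matrix.sum_apply]
    refine Finset.sum_eq_zero fun s _ => ?_
    simp only [Matrix.mul_apply, Finset.sum_mul]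
    refine Finset.sum_eq_zero fun d _ => Finset.sum_eq_zero fun c _ => ?_
    by_contra hne
    simp only [mul_eq_zero, not_or, Matrix.conjTranspose_apply, star_eq_zero] at hne
    obtain ⟨⟨h1, h2⟩, h3⟩ := hne
    refine h2 (hx c d fun h4 => hab ?_)
    rw [h.block s a c h1, h.block s b d h3]
    exact (h.symm s c.1 d.1).2 h4

theorem IsFrame.isFramed_toHom {n m : Fin 4 → ℕ+} {ι : Type} [Fintype ι]
    {W : ι → Matrix (Idx m) (Idx n) ℂ} {σ : ι → Equiv.Perm (Fin 4)} (h : IsFrame W σ) :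
    IsFramed h.toHom W σ :=
  ⟨h, fun _ => rfl⟩

/-- A single isometry of a frame is a frame. -/
theorem IsFrame.const {n m : Fin 4 → ℕ+} {ι : Type}
    {W : ι → Matrix (Idx m) (Idx n) ℂ} {σ : ι → Equiv.Perm (Fin 4)} (h : IsFrame W σ) (s : ι) :
    IsFrame (fun _ : Unit => W s) (fun _ => σ s) :=
  ⟨fun _ => h.symm s, fun _ => h.isometry s, fun _ _ h => absurd rfl h, fun _ => h.block s⟩

/-- Each isometry of the frame alone implements a multiplicity one rigid summand. This certifies
rigidity of maps built from prescribed isometries. -/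
theorem IsFramed.isRigid {n m : Fin 4 → ℕ+} {ι : Type} [Fintype ι] [Nonempty ι]
    {f : StarExtHom (alg n) (alg m)} {W : ι → Matrix (Idx m) (Idx n) ℂ}
    {σ : ι → Equiv.Perm (Fin 4)} (h : IsFramed f W σ) : IsRigid f := by
  have hext (s : ι) (x : Matrix (Idx n) (Idx n) ℂ) :
      (h.toIsFrame.const s).toHom.ext x = W s * x * (W s)ᴴ := by
    rw [(h.toIsFrame.const s).isFramed_toHom.ext_eq]
    simp
  refine ⟨ι, inferInstance, fun s => (h.toIsFrame.const s).toHom, σ, inferInstance, ?_, ?_, ?_⟩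
  · intro s
    refine ⟨h.symm s, fun p _ hp => ?_, fun i j _ _ x hx a b hab => ?_⟩
    · rw [hext, rank_isometry_conj (h.isometry s), hp]
    · rw [hext]
      simp only [Matrix.mul_apply, Finset.sum_mul]
      refine Finset.sum_eq_zero fun d _ => Finset.sum_eq_zero fun c _ => ?_
      by_contra hne
      simp only [mul_eq_zero, not_or, Matrix.conjTranspose_apply, star_eq_zero] at hne
      obtain ⟨⟨h1, h2⟩, h3⟩ := hne
      refine h2 (hx c d fun h4 => hab ?_)
      rw [h.block s a c h1, h.block s b d h3, h4.1, h4.2]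
      exact ⟨rfl, rfl⟩
  · intro s t hst x y
    rw [hext, hext]
    calc W s * x * (W s)ᴴ * (W t * y * (W t)ᴴ)
        = W s * x * ((W s)ᴴ * W t) * y * (W t)ᴴ := by simp only [Matrix.mul_assoc]
      _ = 0 := by rw [h.orthogonal s t hst]; simp
  · intro x
    rw [h.ext_eq]
    exact Finset.sum_congr rfl fun s _ => (hext s x).symm

/-- The composition of framed homomorphisms is framed by the products. -/
theorem IsFramed.comp {n m l : Fin 4 → ℕ+} {ι κ : Type} [Fintype ι] [Fintype κ]
    {f : StarExtHom (alg n) (alg m)} {W : ι → Matrix (Idx m) (Idx n) ℂ}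
    {σ : ι → Equiv.Perm (Fin 4)} (hf : IsFramed f W σ)
    {g : StarExtHom (alg m) (alg l)} {V : κ → Matrix (Idx l) (Idx m) ℂ}
    {τ : κ → Equiv.Perm (Fin 4)} (hg : IsFramed g V τ)
    {k : StarExtHom (alg n) (alg l)} (hk : ∀ x, k.ext x = g.ext (f.ext x)) :
    IsFramed k (fun s : κ × ι => V s.1 * W s.2) (fun s => τ s.1 * σ s.2) := by
  have hmul (s t : κ × ι) : (V s.1 * W s.2)ᴴ * (V t.1 * W t.2)
      = (W s.2)ᴴ * ((V s.1)ᴴ * V t.1) * W t.2 := by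
    simp only [Matrix.conjTranspose_mul, Matrix.mul_assoc]
  refine ⟨⟨fun s i j => ?_, fun s => ?_, fun s t hst => ?_, fun s a b hab => ?_⟩, fun x => ?_⟩
  · exact (hg.symm s.1 _ _).trans (hf.symm s.2 i j)
  · rw [hmul, hg.isometry, Matrix.mul_one, hf.isometry]
  · rw [hmul]
    by_cases h : s.1 = t.1
    · rw [h, hg.isometry, Matrix.mul_one]
      exact hf.orthogonal _ _ fun h' => hst (Prod.ext h h')
    · rw [hg.orthogonal _ _ h]
      simp
  · rw [Matrix.mul_apply] at hab
    obtain ⟨c, -, hc⟩ := Finset.exists_ne_zero_of_sum_ne_zero hab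
    rw [hg.block s.1 a c (left_ne_zero_of_mul hc), hf.block s.2 c b (right_ne_zero_of_mul hc)]
    rfl
  · rw [hk, hg.ext_eq, Fintype.sum_prod_type]
    refine Finset.sum_congr rfl fun s _ => ?_
    rw [hf.ext_eq, Matrix.mul_sum, Matrix.sum_mul]
    refine Finset.sum_congr rfl fun t _ => ?_
    simp only [Matrix.conjTranspose_mul, Matrix.mul_assoc]

theorem IsRigid.comp {n m l : Fin 4 → ℕ+} {f : StarExtHom (alg n) (alg m)} (hf : IsRigid f)
    {g : StarExtHom (alg m) (alg l)} (hg : IsRigid g) {k : StarExtHom (alg n) (alg l)}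
    (hk : ∀ x, k.ext x = g.ext (f.ext x)) : IsRigid k := by
  obtain ⟨ι, _, W, σ, _, hW⟩ := hf.exists_isFramed
  obtain ⟨κ, _, V, τ, _, hV⟩ := hg.exists_isFramed
  exact (hW.comp hV hk).isRigid

theorem isFramed_id (n : Fin 4 → ℕ+) : IsFramed (RegHom.id (alg n)).toStarExtHom
    (fun _ : Unit => (1 : Matrix (Idx n) (Idx n) ℂ)) (fun _ => 1) :=
  ⟨⟨fun _ _ _ => Iff.rfl, fun _ => by simp, fun _ _ h => absurd rfl h, fun _ a b hab => by
    by_contra h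
    exact hab (Matrix.one_apply_ne fun h' => h (by rw [h']; rfl))⟩, fun x => by
    simp [RegHom.id]⟩

theorem Idx.ext_one {a b : Idx fun _ => 1} (h : a.1 = b.1) : a = b := by
  obtain ⟨i, a⟩ := a
  obtain ⟨j, b⟩ := b
  obtain rfl : i = j := h
  have : a = b := Fin.ext (by have := a.2; have := b.2; simp at *; omega)
  rw [this]

/-- The inclusion of `A(D₄)` as the corner of the first indices of the blocks. -/
theorem exists_isFramed_corner (n : Fin 4 → ℕ+) :
    ∃ (φ : StarExtHom algD4 (alg n)) (W : Matrix (Idx n) (Idx fun _ => 1) ℂ),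
      IsFramed φ (fun _ : Unit => W) fun _ => 1 := by
  let W : Matrix (Idx n) (Idx fun _ => 1) ℂ := Matrix.of fun a b =>
    if a = firstIdx n b.1 then 1 else 0
  have hW : IsFrame (fun _ : Unit => W) (fun _ => 1) := by
    refine ⟨fun _ _ _ => Iff.rfl, fun _ => ?_, fun _ _ h => absurd rfl h, fun _ a b hab => ?_⟩
    · ext b d
      have hbd : firstIdx n b.1 = firstIdx n d.1 ↔ b = d :=
        ⟨fun h => Idx.ext_one (congrArg (fun a : Idx n => a.1) h), fun h => by rw [h]⟩
      rw [Matrix.mul_apply, Matrix.one_apply, Finset.sum_eq_single (firstIdx n b.1)]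
      · simp [W, hbd]
      · intro c _ hc
        simp [W, hc]
      · exact fun h => absurd (Finset.mem_univ _) h
    · by_cases h : a = firstIdx n b.1
      · rw [h]; rfl
      · simp [W, h] at hab
  exact ⟨hW.toHom, W, hW.isFramed_toHom⟩

/-! ### Block projections and block traces -/

/-- The projection onto the block `i`. -/
def blockProj (n : Fin 4 → ℕ+) (i : Fin 4) : Matrix (Idx n) (Idx n) ℂ :=
  Matrix.diagonal fun a => if a.1 = i then 1 else 0

variable {n m l : Fin 4 → ℕ+}

theorem blockProj_mul_apply (i : Fin 4) (x : Matrix (Idx n) (Idx n) ℂ) (a b : Idx n) :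
    (blockProj n i * x) a b = if a.1 = i then x a b else 0 := by
  simp [blockProj, Matrix.diagonal_mul]

theorem mul_blockProj_apply {I : Type} (i : Fin 4) (x : Matrix I (Idx n) ℂ) (a : I) (b : Idx n) :
    (x * blockProj n i) a b = if b.1 = i then x a b else 0 := by
  simp [blockProj, Matrix.mul_diagonal]

theorem blockProj_mul_self (i : Fin 4) : blockProj n i * blockProj n i = blockProj n i := by
  simp [blockProj]

theorem blockProj_mul_of_ne {i j : Fin 4} (h : i ≠ j) : blockProj n i * blockProj n j = 0 := by
  rw [blockProj, blockProj, Matrix.diagonal_mul_diagonal, ← Matrix.diagonal_zero]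
  congr 1
  ext a
  by_cases h1 : a.1 = i <;> by_cases h2 : a.1 = j <;> simp_all

theorem sum_blockProj : ∑ i, blockProj n i = 1 := by
  ext a b
  rw [Matrix.sum_apply]
  by_cases h : a = b
  · subst h
    simp [blockProj]
  · simp [blockProj, h]

theorem blockProj_mul_unitMat (i j k : Fin 4) :
    blockProj n k * unitMat n i j = if i = k then unitMat n i j else 0 := by
  ext a b
  rw [blockProj_mul_apply]
  by_cases ha : a = firstIdx n i
  · subst ha
    change (if i = k then _ else _) = _
    split_ifs <;> rfl
  · have : unitMat n i j a b = 0 :=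
      Matrix.single_apply_of_ne _ _ _ _ _ (fun h => ha h.1.symm)
    split_ifs <;> simp [this]

theorem blockProj_conjTranspose (i : Fin 4) : (blockProj n i)ᴴ = blockProj n i := by
  rw [blockProj, Matrix.diagonal_conjTranspose]
  congr 1
  ext a
  simp only [Pi.star_apply]
  split_ifs <;> simp

theorem unitMat_mul_blockProj (i j k : Fin 4) :
    unitMat n i j * blockProj n k = if j = k then unitMat n i j else 0 := by
  have := congrArg Matrix.conjTranspose (blockProj_mul_unitMat (n := n) j i k)
  rw [Matrix.conjTranspose_mul, blockProj_conjTranspose, ← Matrix.star_eq_conjTranspose,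
    star_unitMat] at this
  rw [this]
  split_ifs
  · rw [← Matrix.star_eq_conjTranspose, star_unitMat]
  · simp

theorem blockProj_mul_mul_blockProj {x : Matrix (Idx n) (Idx n) ℂ} (hx : x ∈ alg n) {i j : Fin 4}
    (h : ¬ D4 i j) : blockProj n i * x * blockProj n j = 0 := by
  ext a b
  rw [mul_blockProj_apply, blockProj_mul_apply]
  split_ifs with h1 h2
  · exact hx a b (by rwa [h1, h2])
  all_goals rfl

/-- Apart from loops, no edge of `D₄` is reversible, so elements of `A ∩ A*` are block diagonal. -/
theorem commute_blockProj {x : Matrix (Idx n) (Idx n) ℂ} (hx : x ∈ selfAdj (alg n)) (i : Fin 4) :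
    blockProj n i * x = x * blockProj n i := by
  ext a b
  rw [mul_blockProj_apply, blockProj_mul_apply]
  by_cases h : a.1 = b.1
  · rw [h]
  · have h0 : x a b = 0 := by
      by_cases h1 : D4 a.1 b.1
      · have h2 : ¬ D4 b.1 a.1 := by
          unfold D4 at *
          omega
        have h3 : star (x a b) = 0 := hx.2 b a h2
        exact star_eq_zero.1 h3
      · exact hx.1 a b h1
    simp [h0]

/-- The trace of the block `(j, j)`. -/
def blockTrace (n : Fin 4 → ℕ+) (j : Fin 4) : Matrix (Idx n) (Idx n) ℂ →+ ℂ where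
  toFun x := (blockProj n j * x).trace
  map_zero' := by simp
  map_add' x y := by rw [Matrix.mul_add, Matrix.trace_add]

theorem blockTrace_apply (j : Fin 4) (x : Matrix (Idx n) (Idx n) ℂ) :
    blockTrace n j x = (blockProj n j * x).trace := rfl

/-- It suffices that one factor commutes with the block projection. This is the trace property that
makes the block trace well defined on `K₀`. -/
theorem blockTrace_mul_comm {x : Matrix (Idx n) (Idx n) ℂ} (hx : x ∈ selfAdj (alg n)) (j : Fin 4)
    (y : Matrix (Idx n) (Idx n) ℂ) : blockTrace n j (x * y) = blockTrace n j (y * x) := by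
  rw [blockTrace_apply, blockTrace_apply, ← Matrix.mul_assoc, commute_blockProj hx,
    Matrix.mul_assoc, Matrix.trace_mul_comm, Matrix.mul_assoc]

/-- The homomorphism on `K₀` given by the trace of the block `(j, j)`. -/
def K0.blockTrace (n : Fin 4 → ℕ+) (j : Fin 4) : K0Alg (alg n) →+ ℂ :=
  QuotientAddGroup.lift _
    (FreeAbelianGroup.lift fun p : MatProj (selfAdj (alg n)) =>
      ∑ k, CycleAlg.blockTrace n j (p.2.1 k k).1) (by
    rw [AddSubgroup.closure_le]
    rintro _ (⟨N, M, p, q, v, hp, hq⟩ | ⟨N, M, p, q, r, h⟩)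
    · change FreeAbelianGroup.lift _ _ = 0
      rw [map_sub, FreeAbelianGroup.lift_apply_of, FreeAbelianGroup.lift_apply_of, sub_eq_zero]
      simp only [← hp, ← hq, Matrix.mul_apply, Matrix.conjTranspose_apply,
        AddSubmonoidClass.coe_finsetSum, map_sum]
      -- After the exchange of sums, the traces of `v*v` and `vv*` agree term by term.
      rw [Finset.sum_comm]
      refine Finset.sum_congr rfl fun k _ => Finset.sum_congr rfl fun l _ => ?_
      exact blockTrace_mul_comm (star (v k l)).2 j _
    · change FreeAbelianGroup.lift _ _ = 0
      rw [map_sub, map_sub, FreeAbelianGroup.lift_apply_of, FreeAbelianGroup.lift_apply_of,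
        FreeAbelianGroup.lift_apply_of]
      simp only [h, Fin.sum_univ_add]
      simp)

theorem K0.blockTrace_map_ofProj (f : StarExtHom (alg n) (alg m)) (p : selfAdj (alg n))
    (hp : IsStarProjection p) (j : Fin 4) :
    K0.blockTrace m j (f.mapK0 (K0.ofProj p hp)) = CycleAlg.blockTrace m j (f.ext p.1) := by
  change FreeAbelianGroup.lift _ (FreeAbelianGroup.map _ (FreeAbelianGroup.of _)) = _
  rw [FreeAbelianGroup.map_of_apply, FreeAbelianGroup.lift_apply_of]
  exact Fin.sum_univ_one _

/-- The block condition as an intertwining relation, used to move block projections through the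
isometries. -/
theorem IsFrame.blockProj_mul {ι : Type} {W : ι → Matrix (Idx m) (Idx n) ℂ}
    {σ : ι → Equiv.Perm (Fin 4)} (h : IsFrame W σ) (s : ι) (i : Fin 4) :
    blockProj m (σ s i) * W s = W s * blockProj n i := by
  ext a b
  rw [blockProj, blockProj, Matrix.diagonal_mul, Matrix.mul_diagonal]
  by_cases h0 : W s a b = 0
  · simp [h0]
  · simp [h.block s a b h0]

theorem IsFramed.blockTrace_unitMat {ι : Type} [Fintype ι] {f : StarExtHom (alg n) (alg m)}
    {W : ι → Matrix (Idx m) (Idx n) ℂ} {σ : ι → Equiv.Perm (Fin 4)} (h : IsFramed f W σ)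
    (i j : Fin 4) :
    blockTrace m j (f.ext (unitMat n i i)) = Fintype.card {s // σ s i = j} := by
  rw [h.ext_eq, map_sum, Fintype.card_subtype, Finset.card_filter, Nat.cast_sum]
  refine Finset.sum_congr rfl fun s _ => ?_
  -- Writing the target block as `σ s j'` lets its projection pass through `W s`, leaving the trace
  -- of a block projection times a matrix unit.
  obtain ⟨j', rfl⟩ := (σ s).surjective j
  rw [blockTrace_apply, ← Matrix.mul_assoc, ← Matrix.mul_assoc, h.blockProj_mul,
    Matrix.mul_assoc (W s), blockProj_mul_unitMat, Matrix.trace_mul_comm, ← Matrix.mul_assoc, h.isometry,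
    Matrix.one_mul]
  simp only [(σ s).injective.eq_iff]
  split_ifs <;> simp [unitMat]

/-! ### The weight of a regular partial isometry -/

/-- The squared Hilbert-Schmidt norm of the block `(0, 2)`. -/
def weight (v : Matrix (Idx n) (Idx n) ℂ) : ℂ :=
  (blockProj n 0 * v * blockProj n 2 * vᴴ).trace

theorem weight_unitary {u w v : Matrix (Idx n) (Idx n) ℂ} (hu : IsUnitaryIn (alg n) u)
    (hw : IsUnitaryIn (alg n) w) : weight (u * v * w) = weight v := by
  have hu1 := hu.2.1
  have hw1 := hw.2.2
  rw [Matrix.star_eq_conjTranspose] at hu1 hw1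
  unfold weight
  calc (blockProj n 0 * (u * v * w) * blockProj n 2 * (u * v * w)ᴴ).trace
      = ((blockProj n 0 * u) * v * (w * blockProj n 2) * wᴴ * vᴴ * uᴴ).trace := by
        simp only [Matrix.conjTranspose_mul, Matrix.mul_assoc]
    _ = (u * (blockProj n 0 * v * blockProj n 2 * (w * wᴴ) * vᴴ * uᴴ)).trace := by
        rw [commute_blockProj hu.1, ← commute_blockProj hw.1]
        simp only [Matrix.mul_assoc]
    _ = (blockProj n 0 * v * blockProj n 2 * vᴴ * (uᴴ * u)).trace := by
        rw [Matrix.trace_mul_comm, hw1, Matrix.mul_one]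
        simp only [Matrix.mul_assoc]
    _ = _ := by rw [hu1, Matrix.mul_one]

/-- The initial projection commutes with block projections. -/
theorem IsRegularPI.initial_mem_selfAdj {v : Matrix (Idx n) (Idx n) ℂ}
    (hv : IsRegularPI (alg n) v) : vᴴ * v ∈ selfAdj (alg n) :=
  ⟨hv.initial.1, by rw [← Matrix.star_eq_conjTranspose, star_mul, star_star]; exact hv.initial.1⟩

theorem IsRegularPI.final_mem_selfAdj {v : Matrix (Idx n) (Idx n) ℂ}
    (hv : IsRegularPI (alg n) v) : v * vᴴ ∈ selfAdj (alg n) :=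
  ⟨hv.final.1, by rw [← Matrix.star_eq_conjTranspose, star_mul, star_star]; exact hv.final.1⟩

theorem mem_of_isRegularPI {v : Matrix (Idx n) (Idx n) ℂ}
    (hv : IsRegularPI (alg n) v) : v ∈ alg n := by
  obtain ⟨ι, _, w, hw, -, rfl⟩ := hv
  exact (alg n).sum_mem fun s _ => (hw s).mem

/-- The difference `d` of the two sides satisfies `dᴴ d = 0`, by idempotency. -/
theorem mul_conjTranspose_mul_self {I J : Type} [Fintype I] [Fintype J]
    {v : Matrix I J ℂ} (hv : IsIdempotentElem (vᴴ * v)) : v * vᴴ * v = v := by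
  have hv' : vᴴ * v * (vᴴ * v) = vᴴ * v := hv
  have h : (v * vᴴ * v - v)ᴴ * (v * vᴴ * v - v) = 0 := by
    have e : (v * vᴴ * v - v)ᴴ * (v * vᴴ * v - v)
        = vᴴ * v * (vᴴ * v) * (vᴴ * v) - vᴴ * v * (vᴴ * v) - vᴴ * v * (vᴴ * v) + vᴴ * v := by
      simp only [Matrix.conjTranspose_sub, Matrix.conjTranspose_mul, Matrix.conjTranspose_conjTranspose,
        Matrix.sub_mul, Matrix.mul_sub, Matrix.mul_assoc]
      abel
    rw [e, hv', hv']
    abel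
  open scoped ComplexOrder in
  exact sub_eq_zero.1 (Matrix.conjTranspose_mul_self_eq_zero.1 h)

theorem IsRegularPI.mul_conjTranspose_mul_self {v : Matrix (Idx n) (Idx n) ℂ}
    (hv : IsRegularPI (alg n) v) : v * vᴴ * v = v :=
  CycleAlg.mul_conjTranspose_mul_self hv.initial.2.isIdempotentElem

/-- For orthogonal `v` and `w` the products `v p w*` with block projections `p` vanish. -/
theorem mul_blockProj_mul_conjTranspose {v w : Matrix (Idx n) (Idx n) ℂ}
    (hw : IsRegularPI (alg n) w) (h : v * wᴴ = 0) (i : Fin 4) :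
    v * blockProj n i * wᴴ = 0 := by
  -- The initial projection `wᴴ w` commutes with the block projection, so inserting it and commuting
  -- brings `v` next to `wᴴ`.
  have h1 : wᴴ = wᴴ * w * wᴴ := by
    have := congrArg Matrix.conjTranspose hw.mul_conjTranspose_mul_self
    simpa [Matrix.mul_assoc] using this.symm
  rw [h1, Matrix.mul_assoc, ← Matrix.mul_assoc (blockProj n i),
    commute_blockProj hw.initial_mem_selfAdj]
  simp only [← Matrix.mul_assoc]
  rw [h]
  simp

theorem weight_add {v w : Matrix (Idx n) (Idx n) ℂ} (hv : IsRegularPI (alg n) v)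
    (hw : IsRegularPI (alg n) w) (h : v * wᴴ = 0) : weight (v + w) = weight v + weight w := by
  have h1 := mul_blockProj_mul_conjTranspose hw h 2
  have h' : w * vᴴ = 0 := by
    have := congrArg Matrix.conjTranspose h
    simpa using this
  have h2 := mul_blockProj_mul_conjTranspose hv h' 2
  have e : blockProj n 0 * (v + w) * blockProj n 2 * (v + w)ᴴ
      = blockProj n 0 * v * blockProj n 2 * vᴴ + blockProj n 0 * w * blockProj n 2 * wᴴ
        + (blockProj n 0 * (v * blockProj n 2 * wᴴ)
        + blockProj n 0 * (w * blockProj n 2 * vᴴ)) := by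
    simp only [Matrix.conjTranspose_add, Matrix.add_mul, Matrix.mul_add, Matrix.mul_assoc]
    abel
  unfold weight
  rw [e, h1, h2]
  simp

/-- Both `w wᴴ` and its compressed version are multiples of the same `x x*`, the first by a nonzero
scalar. Since `w wᴴ` is block diagonal, so is the other. -/
theorem IsRankOnePI.blockProj_mul {w : Matrix (Idx n) (Idx n) ℂ} (hw : IsRankOnePI (alg n) w)
    {i j : Fin 4} (hij : i ≠ j) (k : Fin 4) :
    blockProj n i * (w * blockProj n k * wᴴ) * blockProj n j = 0 := by
  obtain ⟨x, y, hxy⟩ := exists_vecMulVec_of_rank_eq_one hw.rank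
  have hww : w * wᴴ = (y ⬝ᵥ star y) • Matrix.vecMulVec x (star x) := by
    rw [hxy, Matrix.conjTranspose_vecMulVec, Matrix.vecMulVec_mul_vecMulVec,
      Matrix.vecMulVec_smul]
  have hwk : w * blockProj n k * wᴴ
      = (y ᵥ* blockProj n k ⬝ᵥ star y) • Matrix.vecMulVec x (star x) := by
    rw [hxy, Matrix.conjTranspose_vecMulVec, Matrix.vecMulVec_mul, Matrix.vecMulVec_mul_vecMulVec,
      Matrix.vecMulVec_smul]
  have hmem : w * wᴴ ∈ selfAdj (alg n) := ⟨hw.final_mem, by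
    rw [← Matrix.star_eq_conjTranspose, star_mul, star_star]; exact hw.final_mem⟩
  have h0 : blockProj n i * (w * wᴴ) * blockProj n j = 0 := by
    rw [commute_blockProj hmem, Matrix.mul_assoc, blockProj_mul_of_ne hij, Matrix.mul_zero]
  have hy : y ⬝ᵥ star y ≠ 0 := by
    open scoped ComplexOrder in
    rw [Ne, dotProduct_self_star_eq_zero]
    rintro rfl
    have := hw.rank
    rw [hxy] at this
    simp at this
  rw [hww, Matrix.mul_smul, Matrix.smul_mul, smul_eq_zero] at h0
  rw [hwk, Matrix.mul_smul, Matrix.smul_mul, h0.resolve_left hy, smul_zero]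

theorem IsRegularPI.of_isRankOnePI {w : Matrix (Idx n) (Idx n) ℂ} (hw : IsRankOnePI (alg n) w) :
    IsRegularPI (alg n) w :=
  ⟨Unit, inferInstance, fun _ => w, fun _ => hw, fun _ _ h => absurd rfl h, by simp⟩

/-- Distinct rank one summands give no cross terms, which reduces to the rank one case. This
property kills the cross terms in `weight_mul`. -/
theorem IsRegularPI.blockProj_mul {v : Matrix (Idx n) (Idx n) ℂ} (hv : IsRegularPI (alg n) v)
    {i j : Fin 4} (hij : i ≠ j) (k : Fin 4) :
    blockProj n i * (v * blockProj n k * vᴴ) * blockProj n j = 0 := by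
  obtain ⟨ι, _, w, hw, ho, rfl⟩ := hv
  simp only [Matrix.conjTranspose_sum, Matrix.sum_mul, Matrix.mul_sum]
  refine Finset.sum_eq_zero fun s _ => Finset.sum_eq_zero fun t _ => ?_
  by_cases hst : t = s
  · subst hst
    exact (hw t).blockProj_mul hij k
  · rw [mul_blockProj_mul_conjTranspose (IsRegularPI.of_isRankOnePI (hw s)) (ho t s hst).2]
    simp

/-- The weight is additive on composable regular partial isometries. -/
theorem weight_mul {v w : Matrix (Idx n) (Idx n) ℂ} (hv : IsRegularPI (alg n) v)
    (hw : IsRegularPI (alg n) w) (h : vᴴ * v = w * wᴴ) :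
    weight (v * w) = weight v + weight w := by
  have hvA := mem_of_isRegularPI hv
  have hwA := mem_of_isRegularPI hw
  set p := blockProj n with hp
  set X := p 0 * v * p 0 * w * p 2 with hX
  set Y := p 0 * v * p 2 * w * p 2 with hY
  have hpp (i : Fin 4) : p i * p i = p i := blockProj_mul_self i
  have hps (i : Fin 4) : (p i)ᴴ = p i := blockProj_conjTranspose i
  have hXh : Xᴴ = p 2 * wᴴ * p 0 * vᴴ * p 0 := by
    simp only [hX, Matrix.conjTranspose_mul, hps, Matrix.mul_assoc]
  have hYh : Yᴴ = p 2 * wᴴ * p 2 * vᴴ * p 0 := by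
    simp only [hY, Matrix.conjTranspose_mul, hps, Matrix.mul_assoc]
  -- Of the four intermediate blocks, only `0` and `2` contribute: `(0, 1)` and `(3, 2)` are not
  -- edges.
  have hXY : p 0 * (v * w) * p 2 = X + Y := by
    have h1 : p 0 * v * p 1 = 0 := blockProj_mul_mul_blockProj hvA (by decide)
    have h3 : p 3 * w * p 2 = 0 := blockProj_mul_mul_blockProj hwA (by decide)
    calc p 0 * (v * w) * p 2 = p 0 * v * (∑ i, p i) * w * p 2 := by
          rw [sum_blockProj, Matrix.mul_one, ← Matrix.mul_assoc (p 0)]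
      _ = X + (p 0 * v * p 1) * w * p 2 + Y + p 0 * v * (p 3 * w * p 2) := by
          simp only [Fin.sum_univ_four, Matrix.mul_add, Matrix.add_mul, hX, hY, Matrix.mul_assoc]
      _ = X + Y := by rw [h1, h3]; simp
  -- The cross term contains an off-diagonal compression of `w p₂ wᴴ`, which vanishes by regularity.
  have hXYh : X * Yᴴ = 0 := by
    calc X * Yᴴ = p 0 * v * (p 0 * (w * (p 2 * p 2) * wᴴ) * p 2) * vᴴ * p 0 := by
          rw [hYh, hX]; simp only [Matrix.mul_assoc]
      _ = 0 := by rw [hpp, hw.blockProj_mul (by decide)]; simp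
  have hYXh : Y * Xᴴ = 0 := by
    calc Y * Xᴴ = p 0 * v * (p 2 * (w * (p 2 * p 2) * wᴴ) * p 0) * vᴴ * p 0 := by
          rw [hXh, hY]; simp only [Matrix.mul_assoc]
      _ = 0 := by rw [hpp, hw.blockProj_mul (by decide)]; simp
  -- The loop is the only edge leaving vertex `2`, and likewise, for `hv0`, the only edge entering
  -- vertex `0`.
  have hw2 : p 2 * w * p 2 = p 2 * w := by
    have h0 : p 2 * w * p 0 = 0 := blockProj_mul_mul_blockProj hwA (by decide)
    have h1 : p 2 * w * p 1 = 0 := blockProj_mul_mul_blockProj hwA (by decide)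
    have h3 : p 2 * w * p 3 = 0 := blockProj_mul_mul_blockProj hwA (by decide)
    calc p 2 * w * p 2 = p 2 * w * ∑ i, p i := by
          simp only [Fin.sum_univ_four, Matrix.mul_add, h0, h1, h3, zero_add, add_zero]
      _ = p 2 * w := by rw [sum_blockProj, Matrix.mul_one]
  have hv0 : p 0 * v * p 0 = v * p 0 := by
    have h0 : p 1 * v * p 0 = 0 := blockProj_mul_mul_blockProj hvA (by decide)
    have h1 : p 2 * v * p 0 = 0 := blockProj_mul_mul_blockProj hvA (by decide)
    have h3 : p 3 * v * p 0 = 0 := blockProj_mul_mul_blockProj hvA (by decide)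
    calc p 0 * v * p 0 = (∑ i, p i) * v * p 0 := by
          simp only [Fin.sum_univ_four, Matrix.add_mul, h0, h1, h3, add_zero]
      _ = v * p 0 := by rw [sum_blockProj, Matrix.one_mul]
  have hvv : v * (vᴴ * v) = v := by rw [← Matrix.mul_assoc]; exact hv.mul_conjTranspose_mul_self
  have hww : wᴴ * (w * wᴴ) = wᴴ := by
    have := congrArg Matrix.conjTranspose hw.mul_conjTranspose_mul_self
    simpa using this
  -- Here `w wᴴ` appears and equals `vᴴ v`, which `v` absorbs. For `hXX` the roles of `v` and `w`
  -- are interchanged.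
  have hYY : (Y * Yᴴ).trace = weight v := by
    have e : Y * Yᴴ = p 0 * (v * p 2 * vᴴ * p 0) := by
      calc Y * Yᴴ = p 0 * v * (p 2 * w * p 2) * (p 2 * w * p 2)ᴴ * vᴴ * p 0 := by
            rw [hYh, hY]
            simp only [Matrix.conjTranspose_mul, hps, Matrix.mul_assoc]
        _ = p 0 * v * (p 2 * (w * wᴴ)) * p 2 * vᴴ * p 0 := by
            rw [hw2]
            simp only [Matrix.conjTranspose_mul, hps, Matrix.mul_assoc]
        _ = p 0 * (v * (vᴴ * v)) * (p 2 * p 2) * vᴴ * p 0 := by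
            rw [← h, commute_blockProj hv.initial_mem_selfAdj]
            simp only [Matrix.mul_assoc, hp]
        _ = _ := by rw [hvv, hpp]; simp only [Matrix.mul_assoc]
    rw [e, Matrix.trace_mul_comm, Matrix.mul_assoc, hpp, Matrix.trace_mul_comm, weight]
    simp only [Matrix.mul_assoc, hp]
  have hXX : (X * Xᴴ).trace = weight w := by
    have e : Xᴴ * X = p 2 * (wᴴ * p 0 * w * p 2) := by
      calc Xᴴ * X = p 2 * wᴴ * (p 0 * v * p 0)ᴴ * (p 0 * v * p 0) * w * p 2 := by
            rw [hXh, hX]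
            simp only [Matrix.conjTranspose_mul, hps, Matrix.mul_assoc]
        _ = p 2 * wᴴ * (p 0 * (vᴴ * v)) * p 0 * w * p 2 := by
            rw [hv0]
            simp only [Matrix.conjTranspose_mul, hps, Matrix.mul_assoc]
        _ = p 2 * (wᴴ * (w * wᴴ)) * (p 0 * p 0) * w * p 2 := by
            rw [h, commute_blockProj hw.final_mem_selfAdj]
            simp only [Matrix.mul_assoc, hp]
        _ = _ := by rw [hww, hpp]; simp only [Matrix.mul_assoc]
    rw [Matrix.trace_mul_comm, e, Matrix.trace_mul_comm, Matrix.mul_assoc, hpp,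
      Matrix.mul_assoc, Matrix.mul_assoc, Matrix.trace_mul_comm, weight]
    simp only [Matrix.mul_assoc, hp]
  have hZ : weight (v * w) = ((X + Y) * (X + Y)ᴴ).trace := by
    rw [← hXY]
    symm
    calc (p 0 * (v * w) * p 2 * (p 0 * (v * w) * p 2)ᴴ).trace
        = (p 0 * (v * w) * (p 2 * p 2) * (v * w)ᴴ * p 0).trace := by
          simp only [Matrix.conjTranspose_mul, hps, Matrix.mul_assoc]
      _ = (p 0 * p 0 * (v * w) * p 2 * (v * w)ᴴ).trace := by
          rw [Matrix.trace_mul_comm, hpp]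
          simp only [Matrix.mul_assoc]
      _ = _ := by rw [hpp]; rfl
  rw [hZ, Matrix.conjTranspose_add, Matrix.add_mul, Matrix.mul_add, Matrix.mul_add, hXYh, hYXh,
    add_zero, zero_add, Matrix.trace_add, hXX, hYY, add_comm]

/-- The weight, as a homomorphism on 1-chains. -/
def weightC1 (n : Fin 4 → ℕ+) : C1 (alg n) →+ ℂ :=
  QuotientAddGroup.lift _ (FreeAbelianGroup.lift fun v : RegPI (alg n) => weight v.1) (by
    rw [AddSubgroup.closure_le]
    rintro _ (⟨v, v', u, w, hu, hw, h⟩ | ⟨v, v₁, v₂, hi, hf, h⟩)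
    · change FreeAbelianGroup.lift _ _ = 0
      rw [map_sub, FreeAbelianGroup.lift_apply_of, FreeAbelianGroup.lift_apply_of, h,
        weight_unitary hu hw, sub_self]
    · change FreeAbelianGroup.lift _ _ = 0
      rw [map_sub, map_sub, FreeAbelianGroup.lift_apply_of, FreeAbelianGroup.lift_apply_of,
        FreeAbelianGroup.lift_apply_of, h, weight_add v₁.2 v₂.2 hi]
      abel)

theorem weightC1_mk (v : RegPI (alg n)) : weightC1 n (C1.mk v) = weight v.1 :=
  FreeAbelianGroup.lift_apply_of _ _

/-- The weight, as a homomorphism on `H₁`. -/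
def weightH1 (n : Fin 4 → ℕ+) : H1 (alg n) →+ ℂ :=
  QuotientAddGroup.lift _ ((weightC1 n).comp (boundary (alg n)).ker.subtype) (by
    have key : boundaries (alg n) ≤ (weightC1 n).ker := by
      refine (AddSubgroup.closure_le _).2 ?_
      rintro _ ⟨v₁, v₂, v₃, h, h', rfl⟩
      change weightC1 n _ = 0
      rw [map_sub, map_add, weightC1_mk, weightC1_mk, weightC1_mk, h, weight_mul v₁.2 v₂.2 h',
        sub_self]
    intro x hx
    exact key hx)

/-- Orthogonality removes pairs of distinct summands, and intertwining shows that a summand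
contributes one exactly when it carries the edge `(i, j)` to `(0, 2)`. -/
theorem weight_map_unitMat {ι : Type} [Fintype ι] {f : StarExtHom (alg n) (alg m)}
    {W : ι → Matrix (Idx m) (Idx n) ℂ} {σ : ι → Equiv.Perm (Fin 4)} (h : IsFramed f W σ)
    (i j : Fin 4) :
    weight (f.ext (unitMat n i j)) = ∑ s, if σ s i = 0 ∧ σ s j = 2 then 1 else 0 := by
  have hp (s : ι) (k : Fin 4) : blockProj m k * W s = W s * blockProj n ((σ s).symm k) := by
    conv_lhs => rw [← (σ s).apply_symm_apply k]
    exact h.blockProj_mul s _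
  have hst : (unitMat n i j)ᴴ = unitMat n j i := star_unitMat n i j
  rw [weight, h.ext_eq]
  simp only [Matrix.conjTranspose_sum, Matrix.sum_mul, Matrix.mul_sum, Matrix.trace_sum]
  refine Finset.sum_congr rfl fun s _ => ?_
  rw [Finset.sum_eq_single s]
  · calc _ = ((blockProj m 0 * W s) * unitMat n i j * (W s)ᴴ * (blockProj m 2 * W s)
          * (unitMat n i j)ᴴ * (W s)ᴴ).trace := by
          simp only [Matrix.conjTranspose_mul, Matrix.conjTranspose_conjTranspose,
            Matrix.mul_assoc]
      _ = (W s * (blockProj n ((σ s).symm 0) * unitMat n i j * ((W s)ᴴ * W s)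
          * blockProj n ((σ s).symm 2) * unitMat n j i * (W s)ᴴ)).trace := by
          rw [hp, hp, hst]
          simp only [Matrix.mul_assoc]
      _ = (blockProj n ((σ s).symm 0) * (unitMat n i j * blockProj n ((σ s).symm 2))
          * unitMat n j i * ((W s)ᴴ * W s)).trace := by
          rw [Matrix.trace_mul_comm, h.isometry, Matrix.mul_one]
          simp only [Matrix.mul_assoc, h.isometry]
      _ = _ := by
          rw [h.isometry, Matrix.mul_one, unitMat_mul_blockProj]
          have e (a b : Fin 4) : σ s a = b ↔ a = (σ s).symm b := by
            rw [Equiv.eq_symm_apply]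
          simp only [e]
          by_cases h2 : j = (σ s).symm 2
          · rw [if_pos h2, Matrix.mul_assoc, unitMat_mul, blockProj_mul_unitMat]
            by_cases h0 : i = (σ s).symm 0
            · rw [if_pos h0, if_pos ⟨h0, h2⟩]
              simp [unitMat]
            · simp [h0]
          · simp [h2]
  · intro t _ hts
    calc _ = (blockProj m 0 * W t * unitMat n i j * (W t)ᴴ * (blockProj m 2 * W s)
          * (unitMat n i j)ᴴ * (W s)ᴴ).trace := by
          simp only [Matrix.conjTranspose_mul, Matrix.conjTranspose_conjTranspose,
            Matrix.mul_assoc]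
      _ = (blockProj m 0 * W t * unitMat n i j * ((W t)ᴴ * W s) * blockProj n ((σ s).symm 2)
          * (unitMat n i j)ᴴ * (W s)ᴴ).trace := by
          rw [hp s 2]
          simp only [Matrix.mul_assoc]
      _ = 0 := by rw [h.orthogonal t s hts]; simp
  · exact fun hs => absurd (Finset.mem_univ s) hs

/-- The degree of a symmetry of `D₄`: the coefficient by which it acts on the cycle. -/
def degree (σ : Equiv.Perm (Fin 4)) : ℂ :=
  -- A symmetry carries exactly one edge to `(0, 2)`; the result is the sign of that edge in the
  -- cycle.
  (if σ 0 = 0 ∧ σ 2 = 2 then 1 else 0) - (if σ 1 = 0 ∧ σ 2 = 2 then 1 else 0)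
    + (if σ 1 = 0 ∧ σ 3 = 2 then 1 else 0) - (if σ 0 = 0 ∧ σ 3 = 2 then 1 else 0)

theorem IsFramed.weightH1_map_gen {ι : Type} [Fintype ι] {f : RegHom (alg n) (alg m)}
    {W : ι → Matrix (Idx m) (Idx n) ℂ} {σ : ι → Equiv.Perm (Fin 4)}
    (h : IsFramed f.toStarExtHom W σ) :
    weightH1 m (f.mapH1 (gen n)) = ∑ s, degree (σ s) := by
  have h1 : weightH1 m (f.mapH1 (gen n)) = weightC1 m (f.mapC1 (cycleChain n)) := rfl
  have h2 (i j : Fin 4) (hij : D4 i j) : f.mapC1 (C1.mk (edge n i j hij))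
      = C1.mk (f.mapRegPI (edge n i j hij)) := by
    simp [RegHom.mapC1, C1.mk]
  have h3 (i j : Fin 4) (hij : D4 i j) : weightC1 m (C1.mk (f.mapRegPI (edge n i j hij)))
      = ∑ s, if σ s i = 0 ∧ σ s j = 2 then 1 else 0 := by
    rw [weightC1_mk]
    exact weight_map_unitMat h i j
  rw [h1, cycleChain]
  simp only [map_sub, map_add, h2, h3, degree, Finset.sum_sub_distrib, Finset.sum_add_distrib]

/-- Hence `d` is determined by `h (gen n) = d • gen m`, and `IsFramed.weightH1_map_gen` computes it;
no isomorphism of `H₁` with `ℤ` is needed. -/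
theorem weightH1_gen (n : Fin 4 → ℕ+) : weightH1 n (gen n) = 1 := by
  have h1 : weightH1 n (gen n) = weightC1 n (cycleChain n) := rfl
  have h2 (i j : Fin 4) (hij : D4 i j) :
      weightC1 n (C1.mk (edge n i j hij)) = if i = 0 ∧ j = 2 then 1 else 0 := by
    rw [weightC1_mk]
    exact (weight_map_unitMat (isFramed_id n) i j).trans
      (by by_cases h : i = 0 ∧ j = 2 <;> simp [h])
  rw [h1, cycleChain]
  simp [h2]

/-! ### Functoriality -/

theorem StarExtHom.mapK0_of_ext_eq {f : StarExtHom (alg n) (alg m)}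
    {g : StarExtHom (alg m) (alg l)} {k : StarExtHom (alg n) (alg l)}
    (hk : ∀ x, k.ext x = g.ext (f.ext x)) (x : K0Alg (alg n)) :
    k.mapK0 x = g.mapK0 (f.mapK0 x) := by
  suffices h : k.mapK0 = g.mapK0.comp f.mapK0 from DFunLike.congr_fun h x
  refine QuotientAddGroup.addMonoidHom_ext _ (FreeAbelianGroup.lift_ext _ _ fun p => ?_)
  have h : K0.mapProj k.restrict p = K0.mapProj g.restrict (K0.mapProj f.restrict p) := by
    obtain ⟨N, p, hp⟩ := p
    refine Sigma.ext rfl (heq_of_eq (Subtype.ext ?_))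
    exact Matrix.ext fun i j => Subtype.ext (hk (p i j).1)
  change QuotientAddGroup.mk (FreeAbelianGroup.map _ (FreeAbelianGroup.of p))
    = QuotientAddGroup.mk (FreeAbelianGroup.map _
      (FreeAbelianGroup.map _ (FreeAbelianGroup.of p)))
  rw [FreeAbelianGroup.map_of_apply, FreeAbelianGroup.map_of_apply,
    FreeAbelianGroup.map_of_apply, h]

theorem StarExtHom.mapK0_eq_self {f : StarExtHom (alg n) (alg n)} (hf : ∀ x, f.ext x = x)
    (x : K0Alg (alg n)) : f.mapK0 x = x := by
  suffices h : f.mapK0 = AddMonoidHom.id _ from DFunLike.congr_fun h x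
  refine QuotientAddGroup.addMonoidHom_ext _ (FreeAbelianGroup.lift_ext _ _ fun p => ?_)
  have h : K0.mapProj f.restrict p = p := by
    obtain ⟨N, p, hp⟩ := p
    refine Sigma.ext rfl (heq_of_eq (Subtype.ext ?_))
    exact Matrix.ext fun i j => Subtype.ext (hf (p i j).1)
  change QuotientAddGroup.mk (FreeAbelianGroup.map _ (FreeAbelianGroup.of p))
    = QuotientAddGroup.mk (FreeAbelianGroup.of p)
  rw [FreeAbelianGroup.map_of_apply, h]

/-- Maps which agree on `A ∩ A*` induce the same map on `K₀`. -/
theorem StarExtHom.mapK0_congr {f g : StarExtHom (alg n) (alg m)}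
    (h : ∀ x ∈ selfAdj (alg n), f.ext x = g.ext x) : f.mapK0 = g.mapK0 := by
  have : f.restrict = g.restrict := by
    ext x : 1
    exact Subtype.ext (h x.1 x.2)
  rw [StarExtHom.mapK0, this, StarExtHom.mapK0]

theorem RegHom.mapC1_of_ext_eq {f : RegHom (alg n) (alg m)} {g : RegHom (alg m) (alg l)}
    {k : RegHom (alg n) (alg l)} (hk : ∀ x, k.ext x = g.ext (f.ext x)) (x : C1 (alg n)) :
    k.mapC1 x = g.mapC1 (f.mapC1 x) := by
  suffices h : k.mapC1 = g.mapC1.comp f.mapC1 from DFunLike.congr_fun h x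
  refine QuotientAddGroup.addMonoidHom_ext _ (FreeAbelianGroup.lift_ext _ _ fun v => ?_)
  have h : k.mapRegPI v = g.mapRegPI (f.mapRegPI v) := Subtype.ext (hk _)
  change QuotientAddGroup.mk (FreeAbelianGroup.map _ (FreeAbelianGroup.of v))
    = QuotientAddGroup.mk (FreeAbelianGroup.map _
      (FreeAbelianGroup.map _ (FreeAbelianGroup.of v)))
  rw [FreeAbelianGroup.map_of_apply, FreeAbelianGroup.map_of_apply,
    FreeAbelianGroup.map_of_apply, h]

theorem RegHom.mapC1_eq_self {f : RegHom (alg n) (alg n)} (hf : ∀ x, f.ext x = x)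
    (x : C1 (alg n)) : f.mapC1 x = x := by
  suffices h : f.mapC1 = AddMonoidHom.id _ from DFunLike.congr_fun h x
  refine QuotientAddGroup.addMonoidHom_ext _ (FreeAbelianGroup.lift_ext _ _ fun v => ?_)
  have h : f.mapRegPI v = v := Subtype.ext (hf _)
  change QuotientAddGroup.mk (FreeAbelianGroup.map _ (FreeAbelianGroup.of v))
    = QuotientAddGroup.mk (FreeAbelianGroup.of v)
  rw [FreeAbelianGroup.map_of_apply, h]

theorem RegHom.mapH1_of_ext_eq {f : RegHom (alg n) (alg m)} {g : RegHom (alg m) (alg l)}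
    {k : RegHom (alg n) (alg l)} (hk : ∀ x, k.ext x = g.ext (f.ext x)) (x : H1 (alg n)) :
    k.mapH1 x = g.mapH1 (f.mapH1 x) := by
  obtain ⟨z, rfl⟩ := QuotientAddGroup.mk_surjective x
  change QuotientAddGroup.mk (k.mapZ1 z) = QuotientAddGroup.mk (g.mapZ1 (f.mapZ1 z))
  congr 1
  exact Subtype.ext (RegHom.mapC1_of_ext_eq hk _)

theorem RegHom.mapH1_eq_self {f : RegHom (alg n) (alg n)} (hf : ∀ x, f.ext x = x)
    (x : H1 (alg n)) : f.mapH1 x = x := by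
  obtain ⟨z, rfl⟩ := QuotientAddGroup.mk_surjective x
  change QuotientAddGroup.mk (f.mapZ1 z) = QuotientAddGroup.mk z
  congr 1
  exact Subtype.ext (RegHom.mapC1_eq_self hf _)

/-! ### Rigid embeddings with given types and given `K₀` -/

/-- If the types `σ` and `τ` have the same multiplicities on the vertices `0` and `2`, they can
be matched vertex by vertex. -/
theorem exists_matching {ι κ : Type} [Fintype ι] [Fintype κ] {σ : ι → Equiv.Perm (Fin 4)}
    {τ : κ → Equiv.Perm (Fin 4)} (hσ : ∀ s, IsSymmetry (σ s)) (hτ : ∀ t, IsSymmetry (τ t))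
    (h0 : ∀ j, Fintype.card {s // σ s 0 = j} = Fintype.card {t // τ t 0 = j})
    (h2 : ∀ j, Fintype.card {s // σ s 2 = j} = Fintype.card {t // τ t 2 = j}) :
    ∃ e : Fin 4 → ι ≃ κ, ∀ i s, τ (e i s) i = σ s i := by
  -- Fibres of equal size are matched one by one, so the bijection preserves the image of vertex
  -- `i`.
  let e (i : Fin 4)
      (h : ∀ j, Fintype.card {s // σ s i = j} = Fintype.card {t // τ t i = j}) : ι ≃ κ :=
    Equiv.ofFiberEquiv (f := fun s => σ s i) (g := fun t => τ t i)
      fun j => Fintype.equivOfCardEq (h j)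
  have he (i h s) : τ (e i h s) i = σ s i :=
    Equiv.ofFiberEquiv_map (f := fun s => σ s i) (g := fun t => τ t i) _ s
  -- Vertices `0, 1` share a bijection, as do `2, 3`. The two bijections are unrelated, which is the
  -- freedom that lets the homology change.
  refine ⟨![e 0 h0, e 0 h0, e 2 h2, e 2 h2], fun i s => ?_⟩
  fin_cases i
  · exact he 0 h0 s
  · change τ (e 0 h0 s) 1 = σ s 1
    rw [(hτ _).apply_one, (hσ _).apply_one, he]
  · exact he 2 h2 s
  · change τ (e 2 h2 s) 3 = σ s 3
    rw [(hτ _).apply_three, (hσ _).apply_three, he]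

theorem eq_sum_blockProj {x : Matrix (Idx n) (Idx n) ℂ} (hx : x ∈ selfAdj (alg n)) :
    x = ∑ i, blockProj n i * x * blockProj n i := by
  calc x = (∑ i, blockProj n i) * x := by rw [sum_blockProj, Matrix.one_mul]
    _ = _ := by
      rw [Finset.sum_mul]
      refine Finset.sum_congr rfl fun i _ => ?_
      rw [Matrix.mul_assoc, ← commute_blockProj hx, ← Matrix.mul_assoc, blockProj_mul_self]

/-- Exchanging the blocks of the summands of a rigid embedding along a matching of types gives a
rigid embedding which agrees with it on `A ∩ A*`. -/
theorem IsFramed.exists_of_matching {ι κ : Type} [Fintype ι] [Fintype κ]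
    {f : StarExtHom (alg n) (alg m)} {V : κ → Matrix (Idx m) (Idx n) ℂ}
    {τ : κ → Equiv.Perm (Fin 4)} (hf : IsFramed f V τ) {σ : ι → Equiv.Perm (Fin 4)}
    (hσ : ∀ s, IsSymmetry (σ s)) (e : Fin 4 → ι ≃ κ) (he : ∀ i s, τ (e i s) i = σ s i) :
    ∃ (g : StarExtHom (alg n) (alg m)) (W : ι → Matrix (Idx m) (Idx n) ℂ), IsFramed g W σ ∧
      ∀ x ∈ selfAdj (alg n), g.ext x = f.ext x := by
  -- The new isometry takes its columns in block `i` from the old isometry matched to `s` at vertex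
  -- `i`.
  let W (s : ι) : Matrix (Idx m) (Idx n) ℂ := ∑ i, V (e i s) * blockProj n i
  have hWapply (s : ι) (a : Idx m) (b : Idx n) : W s a b = V (e b.1 s) a b := by
    simp [W, Matrix.sum_apply, mul_blockProj_apply]
  have hmul (s t : ι) : (W s)ᴴ * W t
      = ∑ i, ∑ j, blockProj n i * ((V (e i s))ᴴ * V (e j t)) * blockProj n j := by
    simp only [W, Matrix.conjTranspose_sum, Matrix.sum_mul, Matrix.mul_sum,
      Matrix.conjTranspose_mul, blockProj_conjTranspose, Matrix.mul_assoc]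
    rw [Finset.sum_comm]
  have horth (s t : ι) (i j : Fin 4) (h : ¬ (i = j ∧ s = t)) :
      blockProj n i * ((V (e i s))ᴴ * V (e j t)) * blockProj n j = 0 := by
    -- Columns from the same old isometry lie in different blocks; columns from different ones have
    -- orthogonal ranges.
    by_cases hst : e i s = e j t
    · have hij : i ≠ j := by
        rintro rfl
        exact h ⟨rfl, (e i).injective hst⟩
      rw [hst, hf.isometry, Matrix.mul_one, blockProj_mul_of_ne hij]
    · rw [hf.orthogonal _ _ hst]
      simp
  have hW : IsFrame W σ := by
    refine ⟨hσ, fun s => ?_, fun s t hst => ?_, fun s a b hab => ?_⟩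
    · rw [hmul, ← sum_blockProj]
      refine Finset.sum_congr rfl fun i _ => ?_
      rw [Finset.sum_eq_single i]
      · rw [hf.isometry, Matrix.mul_one, blockProj_mul_self]
      · exact fun j _ hji => horth s s i j fun h => hji h.1.symm
      · exact fun h => absurd (Finset.mem_univ i) h
    · rw [hmul]
      exact Finset.sum_eq_zero fun i _ => Finset.sum_eq_zero fun j _ =>
        horth s t i j fun h => hst h.2
    · rw [hWapply] at hab
      rw [hf.block _ _ _ hab, he]
  refine ⟨hW.toHom, W, hW.isFramed_toHom, fun x hx => ?_⟩
  have hWp (s : ι) (i : Fin 4) : W s * blockProj n i = V (e i s) * blockProj n i := by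
    ext a b
    rw [mul_blockProj_apply, mul_blockProj_apply, hWapply]
    split_ifs with h
    · rw [h]
    · rfl
  have hpW (s : ι) (i : Fin 4) : blockProj n i * (W s)ᴴ = blockProj n i * (V (e i s))ᴴ := by
    have := congrArg Matrix.conjTranspose (hWp s i)
    simpa [blockProj_conjTranspose] using this
  -- A block diagonal `x` meets only one bijection `e i` at a time, so reindexing by it identifies
  -- the two sums.
  rw [eq_sum_blockProj hx, map_sum, map_sum]
  refine Finset.sum_congr rfl fun i _ => ?_
  rw [hW.isFramed_toHom.ext_eq, hf.ext_eq, ← (e i).sum_comp]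
  refine Finset.sum_congr rfl fun s _ => ?_
  calc W s * (blockProj n i * x * blockProj n i) * (W s)ᴴ
      = (W s * blockProj n i) * x * (blockProj n i * (W s)ᴴ) := by
        simp only [Matrix.mul_assoc]
    _ = _ := by
        rw [hWp, hpW]
        simp only [Matrix.mul_assoc]

/-! ### Vertex multiplicities of the types, read from `K₀`. -/

theorem IsFramed.blockTrace_mapK0 {ι : Type} [Fintype ι] {f : StarExtHom algD4 (alg m)}
    {W : ι → Matrix (Idx m) (Idx fun _ => 1) ℂ} {σ : ι → Equiv.Perm (Fin 4)} (h : IsFramed f W σ)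
    (j : Fin 4) :
    K0.blockTrace m j (f.mapK0 (K0.ofProj e11e33 isStarProjection_e11e33))
      = (Fintype.card {s // σ s 0 = j} + Fintype.card {s // σ s 2 = j} : ℕ) := by
  rw [K0.blockTrace_map_ofProj, Nat.cast_add, ← h.blockTrace_unitMat, ← h.blockTrace_unitMat,
    ← map_add, ← map_add]
  rfl

/-- `K₀ f [e₁₁ ⊕ e₃₃]` determines the multiplicities of the types of `f` on the vertices. -/
theorem card_eq_of_mapK0_eq {ι κ : Type} [Fintype ι] [Fintype κ] {f g : StarExtHom algD4 (alg m)}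
    {W : ι → Matrix (Idx m) (Idx fun _ => 1) ℂ} {σ : ι → Equiv.Perm (Fin 4)} (hf : IsFramed f W σ)
    {V : κ → Matrix (Idx m) (Idx fun _ => 1) ℂ} {τ : κ → Equiv.Perm (Fin 4)} (hg : IsFramed g V τ)
    (h : f.mapK0 (K0.ofProj e11e33 isStarProjection_e11e33)
      = g.mapK0 (K0.ofProj e11e33 isStarProjection_e11e33)) (j : Fin 4) :
    Fintype.card {s // σ s 0 = j} = Fintype.card {t // τ t 0 = j} ∧
      Fintype.card {s // σ s 2 = j} = Fintype.card {t // τ t 2 = j} := by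
  have h1 : Fintype.card {s // σ s 0 = j} + Fintype.card {s // σ s 2 = j}
      = Fintype.card {t // τ t 0 = j} + Fintype.card {t // τ t 2 = j} := by
    have := congrArg (K0.blockTrace m j) h
    rw [hf.blockTrace_mapK0, hg.blockTrace_mapK0] at this
    exact_mod_cast this
  -- The trace sees only the sum of two multiplicities, but vertex `0` goes to `{0, 1}` and vertex
  -- `2` to `{2, 3}`, so for each `j` one of them is zero.
  have hz {ι : Type} [Fintype ι] {σ : ι → Equiv.Perm (Fin 4)} (hσ : ∀ s, IsSymmetry (σ s)) :
      if j.val < 2 then Fintype.card {s // σ s 2 = j} = 0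
        else Fintype.card {s // σ s 0 = j} = 0 := by
    split_ifs with hj
    · rw [Fintype.card_eq_zero_iff]
      exact ⟨fun s => by
        have h2 := (hσ s.1).val_lt_two 2
        rw [s.2] at h2
        exact absurd (h2.1 hj) (by decide)⟩
    · rw [Fintype.card_eq_zero_iff]
      exact ⟨fun s => by
        have h2 := (hσ s.1).val_lt_two 0
        rw [s.2] at h2
        exact hj (h2.2 (by decide))⟩
  have hzf := hz hf.symm
  have hzg := hz hg.symm
  split_ifs at hzf hzg <;> omega

/-! ### The direct system -/

namespace GenericSystem

variable (𝒜 : GenericSystem)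

theorem trans_self_ext (i : ℕ) (x) : (𝒜.trans i i le_rfl).ext x = x := by
  rw [trans, Nat.leRec_self]
  rfl

theorem trans_succ (i j : ℕ) (h : i ≤ j) : 𝒜.trans i (j + 1) (h.trans j.le_succ)
    = (𝒜.rigid j).toRegHom.comp (𝒜.trans i j h) :=
  Nat.leRec_succ _ _ h

theorem trans_trans_ext (i j : ℕ) (hij : i ≤ j) (k : ℕ) (hjk : j ≤ k) (x) :
    (𝒜.trans i k (hij.trans hjk)).ext x
      = (𝒜.trans j k hjk).ext ((𝒜.trans i j hij).ext x) := by
  induction k, hjk using Nat.le_induction with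
  | base => rw [trans_self_ext]
  | succ k hjk ih =>
    rw [trans_succ _ _ _ (hij.trans hjk), trans_succ _ _ _ hjk]
    exact congrArg (𝒜.α k).ext ih

theorem isRigid_trans (i j : ℕ) (h : i ≤ j) : IsRigid (𝒜.trans i j h).toStarExtHom := by
  induction j, h using Nat.le_induction with
  | base => exact (isFramed_id _).comp (isFramed_id _) (fun x => 𝒜.trans_self_ext i x) |>.isRigid
  | succ j h ih =>
    exact ih.comp (𝒜.rigid j) fun x => by rw [trans_succ _ _ _ h]; rfl

instance directedSystem_K0 : DirectedSystem (fun k => K0Alg (alg (𝒜.n k)))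
    (fun i j h => (𝒜.trans i j h).toStarExtHom.mapK0) where
  map_self i x := StarExtHom.mapK0_eq_self (𝒜.trans_self_ext i) x
  map_map k j i hij hjk x := (StarExtHom.mapK0_of_ext_eq (𝒜.trans_trans_ext i j hij k hjk) x).symm

instance directedSystem_H1 : DirectedSystem (fun k => H1 (alg (𝒜.n k)))
    (fun i j h => (𝒜.trans i j h).mapH1) where
  map_self i x := RegHom.mapH1_eq_self (𝒜.trans_self_ext i) x
  map_map k j i hij hjk x := (RegHom.mapH1_of_ext_eq (𝒜.trans_trans_ext i j hij k hjk) x).symm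

end GenericSystem

/-- Elements of a direct limit of groups over `ℕ` which are equal are equal at a later stage. -/
theorem exists_eq_of_directLimit_of_eq {G : ℕ → Type} [∀ i, AddCommGroup (G i)]
    {f : ∀ i j, i ≤ j → G i →+ G j} [DirectedSystem G fun i j h => f i j h] {i j : ℕ} {x : G i}
    {y : G j} (h : AddCommGroup.DirectLimit.of G f i x = AddCommGroup.DirectLimit.of G f j y) :
    ∃ N, ∀ k (hi : i ≤ k) (hj : j ≤ k), N ≤ k → f i k hi x = f j k hj y := by
  let k := max i j
  have hi : i ≤ k := le_max_left _ _
  have hj : j ≤ k := le_max_right _ _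
  have h0 : AddCommGroup.DirectLimit.of G f k (f i k hi x - f j k hj y) = 0 := by
    rw [map_sub, AddCommGroup.DirectLimit.of_f, AddCommGroup.DirectLimit.of_f, h, sub_self]
  obtain ⟨N, hN, h1⟩ := AddCommGroup.DirectLimit.of.zero_exact _ _ h0
  refine ⟨N, fun l hil hjl hNl => ?_⟩
  -- Equality persists beyond `N`, so several such equalities can be realised at one common stage.
  have h2 := congrArg (f N l hNl) h1
  rw [map_zero, map_sub, map_sub, sub_eq_zero] at h2
  have h3 {a b c : ℕ} (hab : a ≤ b) (hbc : b ≤ c) (z : G a) :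
      f b c hbc (f a b hab z) = f a c (hab.trans hbc) z :=
    DirectedSystem.map_map (f := fun i j h => f i j h) hab hbc z
  rwa [h3, h3, h3, h3] at h2

end CycleAlg

end

/-- For a generic, hr-asymmetric system of 4-cycle algebras with limit algebra `A`, the joint scale
`ΣA ⊆ K₀A ⊕ H₁A` is not invariant under the homology inversion `id ⊕ -1`. -/
theorem proposition5p8 (𝒜 : CycleAlg.GenericSystem) (h𝒜 : 𝒜.IsHrAsymmetric) :
    𝒜.homologyInversion '' 𝒜.jointScale ≠ 𝒜.jointScale := by
  open CycleAlg in
  intro hinv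
  -- The corner has a single summand, of identity type, so composing a map with it preserves the
  -- types of that map.
  obtain ⟨φ, U, hU⟩ := exists_isFramed_corner (𝒜.n 0)
  have hφ : IsRigid φ := hU.isRigid
  set q := K0.ofProj e11e33 isStarProjection_e11e33
  obtain ⟨l, ψ, hψ, hx⟩ : 𝒜.homologyInversion (𝒜.toK0Lim 0 (φ.mapK0 q),
      𝒜.toH1Lim 0 (hφ.toRegHom.mapH1 (gen _))) ∈ 𝒜.jointScale :=
    hinv ▸ Set.mem_image_of_mem _ ⟨0, φ, hφ, rfl⟩
  have hK : 𝒜.toK0Lim 0 (φ.mapK0 q) = 𝒜.toK0Lim l (ψ.mapK0 q) := congrArg Prod.fst hx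
  have hH : 𝒜.toH1Lim 0 (-hφ.toRegHom.mapH1 (gen _)) = 𝒜.toH1Lim l (hψ.toRegHom.mapH1 (gen _)) :=
    (map_neg _ _).trans (congrArg Prod.snd hx)
  obtain ⟨N, hN⟩ := exists_eq_of_directLimit_of_eq hK
  obtain ⟨M, hM⟩ := exists_eq_of_directLimit_of_eq hH
  -- Strict positivity is required because asymmetry concerns only `i < j`.
  obtain ⟨k, hk0, hkl, hkN, hkM⟩ : ∃ k, 0 < k ∧ l ≤ k ∧ N ≤ k ∧ M ≤ k :=
    ⟨l + N + M + 1, by omega, by omega, by omega, by omega⟩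
  replace hN := hN k hk0.le hkl hkN
  replace hM := hM k hk0.le hkl hkM
  obtain ⟨κ, _, V, τ, _, hα⟩ := (𝒜.isRigid_trans 0 k hk0.le).exists_isFramed
  let χ := (𝒜.trans 0 k hk0.le).comp hφ.toRegHom
  let ω := (𝒜.trans l k hkl).comp hψ.toRegHom
  have hχ := hU.comp hα (k := χ.toStarExtHom) fun _ => rfl
  obtain ⟨ι, _, W, σ, _, hω⟩ :=
    (hψ.comp (𝒜.isRigid_trans l k hkl) (k := ω.toStarExtHom) fun _ => rfl).exists_isFramed
  -- Opposite homology at stage `k`, expressed through the types of the connecting map and of `ω`.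
  have hdeg : -∑ t, degree (τ t) = ∑ s, degree (σ s) := by
    have h1 := congrArg (weightH1 (𝒜.n k)) hM
    rw [map_neg, map_neg, ← RegHom.mapH1_of_ext_eq (k := χ) fun _ => rfl,
      ← RegHom.mapH1_of_ext_eq (k := ω) fun _ => rfl, hχ.weightH1_map_gen,
      hω.weightH1_map_gen, Fintype.sum_prod_type] at h1
    simpa using h1
  have hcard := card_eq_of_mapK0_eq hω hχ (by
    rw [StarExtHom.mapK0_of_ext_eq (k := ω.toStarExtHom) (fun _ => rfl),
      StarExtHom.mapK0_of_ext_eq (k := χ.toStarExtHom) (fun _ => rfl)]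
    exact hN.symm)
  obtain ⟨e, he⟩ := exists_matching hω.symm hχ.symm (fun j => (hcard j).1) fun j => (hcard j).2
  -- The types of `χ` are indexed by `κ × Unit`; dropping the trivial factor turns the matching into
  -- one with the types of the connecting map itself.
  obtain ⟨β, X, hβ, hβα⟩ := hα.exists_of_matching hω.symm
    (fun i => (e i).trans (Equiv.prodPUnit κ)) he
  have hmemβ : hβ.isRigid.toRegHom.mapH1
      ∈ homologyRange (𝒜.trans 0 k hk0.le).toStarExtHom :=
    ⟨β, hβ.isRigid, StarExtHom.mapK0_congr hβα, rfl⟩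
  have hmemα : (𝒜.trans 0 k hk0.le).mapH1
      ∈ homologyRange (𝒜.trans 0 k hk0.le).toStarExtHom :=
    ⟨_, 𝒜.isRigid_trans 0 k hk0.le, rfl, rfl⟩
  have hd {ι : Type} [Fintype ι] {f : RegHom (alg (𝒜.n 0)) (alg (𝒜.n k))}
      {W : ι → Matrix (Idx (𝒜.n k)) (Idx (𝒜.n 0)) ℂ} {σ : ι → Equiv.Perm (Fin 4)}
      (hf : IsFramed f.toStarExtHom W σ) {d : ℤ}
      (h : f.mapH1 (gen (𝒜.n 0)) = d • gen (𝒜.n k)) : ∑ s, degree (σ s) = d := by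
    rw [← hf.weightH1_map_gen, h, map_zsmul, weightH1_gen, zsmul_one]
  -- Both the connecting map and `β` lie in the homology range, with integers `d` and `d' = -d`,
  -- which cannot have the same sign.
  rcases h𝒜 0 k hk0 with h | h <;>
  · obtain ⟨d, hd0, hdα⟩ := h _ hmemα
    obtain ⟨d', hd0', hdβ⟩ := h _ hmemβ
    rw [hd hα hdα, hd (f := hβ.isRigid.toRegHom) hβ hdβ] at hdeg
    have : -d = d' := by exact_mod_cast hdeg
    omega
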